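/- Let $d\in\{2,3\}$ and let $\Omega=[0,2\pi]^d$ with periodic boundary conditions. For a $2\pi$-periodic field $u$ put $\widehat u(k)=(2\pi)^{-d}\int_\Omega u(x)e^{-ik\cdot x}\,dx$, $k\in\mathbb Z^d$. Let $H_{\mathbb C}$ be the space of mean-free, divergence-free $u\in L^2(\Omega;\mathbb C^d)$, i.e. those with $\widehat u(0)=0$ and $k\cdot\widehat u(k)=0$ for all $k$. For $r,\beta>0$ let $$\|u\|_\beta=\|A^{r/2}e^{\beta A^{1/2}}u\|_{L^2}=\Big((2\pi)^d\sum_{k\neq0}|k|^{2r}e^{2\beta|k|}|\widehat u(k)|^2\Big)^{1/2},\qquad A=-\Delta ,$$ and let $B(u,v)=\mathbb P\,\nabla\cdot(u\otimes v)$, complex bilinear, where $\mathbb P$ is the Leray–Helmholtz projection. Put $$C_W(r)=\frac{1}{\pi2^{d-1}}\,\frac{2r-d}{2r-1-d}.$$ **Theorem 3.1.** There is a constant $C>0$ depending only on $d$ such that the following holds for all $r>\frac{d+1}{2}$, all $\beta_0>0$ and all $u_0\in H_{\mathbb C}$ (in particular for real-valued $u_0$) with $\|u_0\|_{\beta_0}<\infty$.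 Put $$\delta=\frac{2^rC_W(r)\|u_0\|_{\beta_0}}{C},\qquad \mathcal R=\{\zeta\in\mathbb C:\ 0<|\zeta|,\ \delta|\zeta|<\beta_0\},$$ so that $\mathcal R$ is the punctured disc $0<|\zeta|<\dfrac{C\beta_0}{2^rC_W(r)\|u_0\|_{\beta_0}}$ (the punctured plane if $u_0=0$). Then the complexified Euler equation $$\frac{du}{d\zeta}+B(u,u)=0,\qquad u(0)=u_0,$$ has a unique solution in $\mathcal R$, that is, a unique function $u:\mathcal R\to H_{\mathbb C}$ which is complex differentiable with respect to the $L^2$ norm, satisfies the equation at every $\zeta\in\mathcal R$, and satisfies $u(\zeta)\to u_0$ in $L^2$ as $\zeta\to0$. Moreover $u$ is holomorphic with values in a Gevrey class: for every $\rho>0$ with $\delta\rho<\beta_0$ the map $\zeta\mapsto A^{r/2}e^{(\beta_0-\delta\rho)A^{1/2}}u(\zeta)$ is defined and holomorphic from $\{0<|\zeta|<\rho\}$ into $L^2(\Omega;\mathbb C^d)$. -/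

import Mathlib

open MeasureTheory Filter Topology
open scoped ENNReal

noncomputable section

namespace EulerGevrey

instance fact_two_pi_pos : Fact ((0 : ℝ) < 2 * Real.pi) := ⟨Real.two_pi_pos⟩

/-- The torus `ℝᵈ / (2πℤ)ᵈ`, i.e. the cube `[0, 2π]ᵈ` with periodic boundary conditions. Its
`volume` is the product measure of total mass `(2π)ᵈ`. -/
abbrev Torus (d : ℕ) : Type := Fin d → AddCircle (2 * Real.pi)

/-- `ℂᵈ` with the Euclidean length. -/
abbrev Vec (d : ℕ) : Type := EuclideanSpace ℂ (Fin d)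

/-- The complex Hilbert space `L²(Ω; ℂᵈ)` of periodic vector fields. -/
abbrev L2 (d : ℕ) : Type := Lp (Vec d) 2 (volume : Measure (Torus d))

/-- Fourier coefficient `f̂(k) = (2π)⁻ᵈ ∫_Ω f(x) e^{-i k·x} dx`. -/
def coeff {d : ℕ} (f : Torus d → Vec d) (k : Fin d → ℤ) : Vec d :=
  (((2 * Real.pi) ^ d)⁻¹ : ℝ) • ∫ x : Torus d, (∏ j, fourier (-(k j)) (x j) : ℂ) • f x

/-- Euclidean length `|k|` of a wave vector. -/
def waveLength {d : ℕ} (k : Fin d → ℤ) : ℝ := Real.sqrt (∑ j, (k j : ℝ) ^ 2)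

/-- The complexified phase space `H_ℂ`: mean-free, divergence-free (in the sense of
distributions, that is `k · û(k) = 0` for all `k`) elements of `L²(Ω; ℂᵈ)`. -/
def HC (d : ℕ) : Set (L2 d) :=
  {u | coeff u 0 = 0 ∧ ∀ k : Fin d → ℤ, ∑ j, (k j : ℂ) * coeff u k j = 0}

/-- Symbol of the Leray-Helmholtz projection at the frequency `k`:
`w ↦ w - (k · w) k / |k|²`. -/
def leray {d : ℕ} (k : Fin d → ℤ) (w : Vec d) : Vec d :=
  WithLp.toLp 2 fun i => w i - (∑ j, (k j : ℂ) * w j) / (∑ j, (k j : ℂ) ^ 2) * (k i : ℂ)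

/-- Fourier coefficient at `k` of the distribution `∇ · (u ⊗ v) = ∑ⱼ ∂ⱼ (uⱼ v)`, for `u`, `v` in
`L²` (so that the products `uⱼ v` are in `L¹`). -/
def divTensorCoeff {d : ℕ} (u v : L2 d) (k : Fin d → ℤ) : Vec d :=
  ∑ j, (Complex.I * (k j : ℂ)) • coeff (fun x => u x j • v x) k

/-- Fourier coefficient at `k` of the (complex bilinear) Euler nonlinearity
`B(u, v) = ℙ ∇ · (u ⊗ v)`. At `k = 0` it vanishes. -/
def eulerBCoeff {d : ℕ} (u v : L2 d) (k : Fin d → ℤ) : Vec d :=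
  leray k (divTensorCoeff u v k)

/-- `u` is a holomorphic `H_ℂ`-valued solution of `du/dζ + B(u, u) = 0` on `S`, with `u(0) = u₀`.
The derivative is the complex derivative in `L²(Ω; ℂᵈ)`. Since `0` need not lie in `S`, the
initial condition is that `u(ζ) → u₀` in `L²` as `ζ → 0` within `S`. -/
structure IsEulerSolution {d : ℕ} (u₀ : L2 d) (S : Set ℂ) (u : ℂ → L2 d) : Prop where
  mem : ∀ ζ ∈ S, u ζ ∈ HC d
  eqn : ∀ ζ ∈ S, ∃ w : L2 d, HasDerivAt u w ζ ∧
    ∀ k : Fin d → ℤ, coeff w k + eulerBCoeff (u ζ) (u ζ) k = 0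
  init : Tendsto u (𝓝[S] 0) (𝓝 u₀)

/-- `‖A^{r/2} e^{β A^{1/2}} u‖ < ∞`. -/
def MemGevrey {d : ℕ} (r β : ℝ) (u : L2 d) : Prop :=
  Summable fun k : Fin d → ℤ =>
    waveLength k ^ (2 * r) * Real.exp (2 * β * waveLength k) * ‖coeff u k‖ ^ 2

/-- The Gevrey norm
`‖A^{r/2} e^{β A^{1/2}} u‖ = ((2π)ᵈ ∑ₖ |k|^{2r} e^{2β|k|} |û(k)|²)^{1/2}`
(meaningful if `MemGevrey r β u`; for `r > 0` the term `k = 0` vanishes). -/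
def gevreyNorm {d : ℕ} (r β : ℝ) (u : L2 d) : ℝ :=
  Real.sqrt ((2 * Real.pi) ^ d * ∑' k : Fin d → ℤ,
    waveLength k ^ (2 * r) * Real.exp (2 * β * waveLength k) * ‖coeff u k‖ ^ 2)

/-- On `S` the map `u` is holomorphic with values in the Gevrey class of radius `β` (with the norm
`‖A^{r/2} e^{β A^{1/2}} ·‖`): there is an `L²`-valued holomorphic `F` with
`F(ζ) = A^{r/2} e^{β A^{1/2}} u(ζ)`. -/
def GevreyHolomorphicOn {d : ℕ} (r β : ℝ) (u : ℂ → L2 d) (S : Set ℂ) : Prop :=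
  ∃ F : ℂ → L2 d, DifferentiableOn ℂ F S ∧ ∀ ζ ∈ S, ∀ k : Fin d → ℤ,
    coeff (F ζ) k = (waveLength k ^ r * Real.exp (β * waveLength k) : ℝ) • coeff (u ζ) k

/-- The constant `C_W(r) = (1 / (π 2^{d-1})) (2r - d) / (2r - 1 - d)` (used for `d ≥ 1`). -/
def wienerConst (d : ℕ) (r : ℝ) : ℝ :=
  1 / (Real.pi * 2 ^ (d - 1)) * ((2 * r - d) / (2 * r - 1 - d))

/-- The quantity `2^r C_W(r) ‖u₀‖_{β₀}`. -/
def dataSize {d : ℕ} (r β₀ : ℝ) (u₀ : L2 d) : ℝ :=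
  (2 : ℝ) ^ r * wienerConst d r * gevreyNorm r β₀ u₀

/-- The punctured disc `0 < |ζ| < C β₀ / (2^r C_W(r) ‖u₀‖_{β₀})`; the inequality is multiplied
out, so that for `u₀ = 0`, where the radius is infinite, this is the punctured plane. -/
def region {d : ℕ} (C r β₀ : ℝ) (u₀ : L2 d) : Set ℂ :=
  {ζ | 0 < ‖ζ‖ ∧ ‖ζ‖ * dataSize r β₀ u₀ < C * β₀}

end EulerGevrey

end

noncomputable section

namespace EulerGevrey

variable {d : ℕ}

/-! ### Exponential monomials on the torus -/

/-! The solution is its own Taylor series at `ζ = 0`. With `u = ∑ ζⁿ uₙ` the equation forces `(n+1)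
uₙ₊₁ = -∑ B(uᵢ, uₙ₋ᵢ)`, and existence reduces to bounding `uₙ` in Gevrey classes of shrinking
radius. Norms of coefficient families live in `[0, ∞]`, so the estimates carry no summability
hypotheses.

For `r ≥ (d+1)/2` the Gevrey class is closed under convolution of mean-free families
(`ell2_gevreyWeight_conv_le`), and one derivative costs `1/(eη)` when the radius drops by `η`. Hence
`‖B(a,b)‖_β ≤ K/(eη) ‖a‖_{β+η} ‖b‖_{β+η}` with `K` equal to `2^r` times a constant of `d`
(`seqGevreyNorm_convB_le`). Induction then gives `‖uₙ‖_{β₀-s} sⁿ ≤ M Catₙ (KM)ⁿ`, where `M` is the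
norm of the data (`seqGevreyNorm_taylorCoeff_mul_le`): losing `s/(n+1)` at a step makes `1/η` cancel
the `1/(n+1)` of the recursion, the `e` pays for `(1+1/n)ⁿ`, and the Catalan recursion matches the
convolution. Since `Catₙ ≤ 4ⁿ`, the series converges in the class of radius `β` for `|ζ| <
(β₀-β)/(4KM)`. As `C_W(r)` is bounded below independently of `r`, a small `C` brings the claimed
disc inside.

For uniqueness, `0` is a removable singularity of any solution. If two solutions differ near `0`,
the leading Taylor coefficient of the difference must vanish (`eventuallyEq_of_quadratic_ode`); the
identity theorem covers the rest of the disc. The equation is tested mode by mode, so no bound on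
`B` uniform in the frequency is used. -/

/-- The character `x ↦ e^{i k·x}` of the torus. -/
def character (k : Fin d → ℤ) : C(Torus d, ℂ) where
  toFun x := ∏ j, fourier (k j) (x j)
  continuous_toFun := by fun_prop

lemma character_apply (k : Fin d → ℤ) (x : Torus d) :
    character k x = ∏ j, fourier (k j) (x j) := rfl

lemma character_neg (k : Fin d → ℤ) (x : Torus d) :
    character (-k) x = starRingEnd ℂ (character k x) := by
  simp only [character_apply, Pi.neg_apply, fourier_neg, map_prod]

lemma character_add (k l : Fin d → ℤ) (x : Torus d) :
    character (k + l) x = character k x * character l x := by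
  simp only [character_apply, Pi.add_apply, fourier_add, ← Finset.prod_mul_distrib]

lemma character_single (x : Torus d) (i : Fin d) :
    character (Pi.single i 1) x = fourier 1 (x i) := by
  rw [character_apply, Finset.prod_eq_single i]
  · simp
  · intro j _ hj
    simp [Pi.single_eq_of_ne hj]
  · simp

lemma integral_fourier (n : ℤ) :
    ∫ x : AddCircle (2 * Real.pi), fourier n x = if n = 0 then ((2 * Real.pi : ℝ) : ℂ) else 0 := by
  split_ifs with h
  · subst h
    simp [Measure.real, AddCircle.measure_univ, Real.pi_pos.le]
  -- Translation by `π/n` changes the sign of `e^{inx}`.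
  · exact integral_eq_zero_of_add_right_eq_neg (fourier_add_half_inv_index h Real.two_pi_pos)

lemma integral_character (k : Fin d → ℤ) :
    ∫ x : Torus d, character k x = if k = 0 then (((2 * Real.pi) ^ d : ℝ) : ℂ) else 0 := by
  simp only [character_apply]
  rw [integral_fintype_prod_volume_eq_prod (fun j (x : AddCircle (2 * Real.pi)) => fourier (k j) x)]
  simp only [integral_fourier]
  split_ifs with h
  · simp [h]
  · obtain ⟨i, hi⟩ := Function.ne_iff.mp h
    exact Finset.prod_eq_zero (Finset.mem_univ i) (if_neg hi)

/-- The linear span of the characters, as a star subalgebra of `C(Torus d, ℂ)`. -/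
def characterSubalgebra (d : ℕ) : StarSubalgebra ℂ C(Torus d, ℂ) where
  toSubalgebra := Algebra.adjoin ℂ (Set.range character)
  star_mem' := by
    change Algebra.adjoin ℂ (Set.range character) ≤ star (Algebra.adjoin ℂ (Set.range character))
    refine Algebra.adjoin_le ?_
    rintro _ ⟨n, rfl⟩
    refine Algebra.subset_adjoin ⟨-n, ?_⟩
    ext1 x
    simp only [character_neg, starRingEnd_apply, ContinuousMap.star_apply]

lemma characterSubalgebra_coe :
    (characterSubalgebra d).toSubalgebra.toSubmodule = Submodule.span ℂ (Set.range character) := by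
  apply Algebra.adjoin_eq_span_of_subset
  refine .trans (fun x ↦ Submonoid.closure_induction (fun _ ↦ id) ⟨0, ?_⟩ ?_)
    Submodule.subset_span
  · ext z
    simp [character_apply]
  · rintro _ _ _ _ ⟨m, rfl⟩ ⟨n, rfl⟩
    exact ⟨m + n, by ext z; exact character_add m n z⟩

lemma characterSubalgebra_separatesPoints : (characterSubalgebra d).SeparatesPoints := by
  intro x y hxy
  rw [Ne, funext_iff, not_forall] at hxy
  obtain ⟨i, hi⟩ := hxy
  refine ⟨_, ⟨character (Pi.single i 1), Algebra.subset_adjoin ⟨Pi.single i 1, rfl⟩, rfl⟩, ?_⟩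
  dsimp only
  rw [character_single, character_single, fourier_one, fourier_one]
  exact fun h => hi (AddCircle.injective_toCircle Real.two_pi_pos.ne' (Circle.ext h))

/-- Stone-Weierstrass: two points differing in coordinate `i` are separated by `e^{i x_i}`. -/
lemma span_character_closure_eq_top :
    (Submodule.span ℂ (Set.range (character (d := d)))).topologicalClosure = ⊤ := by
  rw [← characterSubalgebra_coe]
  exact congr_arg (Subalgebra.toSubmodule <| StarSubalgebra.toSubalgebra ·)
    (ContinuousMap.starSubalgebra_topologicalClosure_eq_top_of_separatesPoints _
      characterSubalgebra_separatesPoints)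

/-! ### The Hilbert sum decomposition of `L²` -/

/-- The field `x ↦ f(x) a` as an element of `L²`. -/
def tensor (a : Vec d) : C(Torus d, ℂ) →L[ℂ] L2 d :=
  (ContinuousMap.toLp 2 (volume : Measure (Torus d)) ℂ).comp
    ((ContinuousLinearMap.toSpanSingleton ℂ a).compLeftContinuous ℂ (Torus d))

lemma coeFn_tensor (a : Vec d) (f : C(Torus d, ℂ)) :
    tensor a f =ᵐ[volume] fun x => f x • a :=
  ContinuousMap.coeFn_toLp volume _

/-- `(2π)^{d/2}`. -/
def volSqrt (d : ℕ) : ℝ := Real.sqrt ((2 * Real.pi) ^ d)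

lemma volSqrt_pos (d : ℕ) : 0 < volSqrt d := Real.sqrt_pos.2 (pow_pos Real.two_pi_pos d)

lemma volSqrt_sq (d : ℕ) : volSqrt d ^ 2 = (2 * Real.pi) ^ d :=
  Real.sq_sqrt (pow_pos Real.two_pi_pos d).le

lemma inner_tensor (k l : Fin d → ℤ) (a b : Vec d) :
    inner ℂ (tensor a (character k)) (tensor b (character l)) =
      if k = l then (((2 * Real.pi) ^ d : ℝ) : ℂ) * inner ℂ a b else 0 := by
  rw [L2.inner_def]
  have : ∀ᵐ x : Torus d, inner ℂ (tensor a (character k) x) (tensor b (character l) x) =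
      character (l - k) x * inner ℂ a b := by
    filter_upwards [coeFn_tensor a (character k), coeFn_tensor b (character l)] with x h1 h2
    rw [h1, h2, inner_smul_left, inner_smul_right, sub_eq_add_neg, character_add, character_neg]
    ring
  rw [integral_congr_ae this, integral_mul_const, integral_character]
  simp only [sub_eq_zero, eq_comm (a := l)]
  split_ifs <;> simp

/-- The normalised mode `(2π)^{-d/2} e^{i k·x} a`. -/
def modeIsometry (k : Fin d → ℤ) : Vec d →ₗᵢ[ℂ] L2 d :=
  LinearMap.isometryOfInner
    { toFun := fun a => ((volSqrt d)⁻¹ : ℂ) • tensor a (character k)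
      map_add' := fun a b => by
        rw [← smul_add]
        congr 1
        apply Lp.ext
        filter_upwards [coeFn_tensor a (character k), coeFn_tensor b (character k),
          coeFn_tensor (a + b) (character k),
          Lp.coeFn_add (tensor a (character k)) (tensor b (character k))] with x h1 h2 h3 h4
        rw [h4, Pi.add_apply, h1, h2, h3, smul_add]
      map_smul' := fun c a => by
        rw [RingHom.id_apply, smul_comm c]
        congr 1
        apply Lp.ext
        filter_upwards [coeFn_tensor a (character k), coeFn_tensor (c • a) (character k),
          Lp.coeFn_smul c (tensor a (character k))] with x h1 h2 h3
        rw [h3, Pi.smul_apply, h1, h2, smul_comm] }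
    (fun a b => by
      change inner ℂ (((volSqrt d)⁻¹ : ℂ) • tensor a (character k))
        (((volSqrt d)⁻¹ : ℂ) • tensor b (character k)) = inner ℂ a b
      rw [inner_smul_left, inner_smul_right, inner_tensor, if_pos rfl, ← volSqrt_sq]
      have : (volSqrt d : ℂ) ≠ 0 := by exact_mod_cast (volSqrt_pos d).ne'
      simp only [map_inv₀, Complex.conj_ofReal]
      push_cast
      field_simp)

lemma modeIsometry_apply (k : Fin d → ℤ) (a : Vec d) :
    modeIsometry k a = ((volSqrt d)⁻¹ : ℂ) • tensor a (character k) := rfl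

lemma orthogonalFamily_modeIsometry :
    OrthogonalFamily ℂ (fun _ : Fin d → ℤ => Vec d) modeIsometry := by
  intro k l hkl a b
  rw [modeIsometry_apply, modeIsometry_apply, inner_smul_left, inner_smul_right, inner_tensor,
    if_neg hkl]
  simp

/-- The preimage of a closed subspace under the continuous map `tensor a` is closed and contains
every character, so it is everything. -/
lemma tensor_mem_closure (a : Vec d) (f : C(Torus d, ℂ)) :
    tensor a f ∈ (⨆ k : Fin d → ℤ,
      LinearMap.range (modeIsometry k).toLinearMap).topologicalClosure := by
  have hle : Submodule.span ℂ (Set.range (character (d := d))) ≤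
      ((⨆ k : Fin d → ℤ, LinearMap.range (modeIsometry k).toLinearMap).topologicalClosure).comap
        (tensor a).toLinearMap := by
    rw [Submodule.span_le]
    rintro _ ⟨k, rfl⟩
    apply Submodule.le_topologicalClosure
    refine Submodule.mem_iSup_of_mem k ⟨(volSqrt d : ℂ) • a, ?_⟩
    have h0 : (volSqrt d : ℂ) ≠ 0 := by exact_mod_cast (volSqrt_pos d).ne'
    rw [map_smul]
    change (volSqrt d : ℂ) • modeIsometry k a = _
    rw [modeIsometry_apply, smul_smul, mul_inv_cancel₀ h0, one_smul]
    rfl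
  have hcl := Submodule.topologicalClosure_minimal _ hle
    ((Submodule.isClosed_topologicalClosure _).preimage (tensor a).continuous)
  rw [span_character_closure_eq_top] at hcl
  exact hcl (Submodule.mem_top (x := f))

lemma toLp_eq_sum_tensor (g : C(Torus d, Vec d)) :
    ContinuousMap.toLp 2 (volume : Measure (Torus d)) ℂ g =
      ∑ i, tensor (EuclideanSpace.single i (1 : ℂ))
        ((EuclideanSpace.proj i : Vec d →L[ℂ] ℂ).compLeftContinuous ℂ (Torus d) g) := by
  simp only [tensor, ContinuousLinearMap.comp_apply, ← map_sum]
  congr 1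
  ext x i
  simp only [ContinuousMap.sum_apply, WithLp.ofLp_sum, Finset.sum_apply]
  rw [Finset.sum_eq_single i]
  · simp
    rfl
  · intro j _ hj
    simp [hj.symm]
  · simp

lemma isHilbertSum_modeIsometry :
    IsHilbertSum ℂ (fun _ : Fin d → ℤ => Vec d) modeIsometry := by
  refine IsHilbertSum.mk orthogonalFamily_modeIsometry fun u _ => ?_
  have hd := ContinuousMap.toLp_denseRange (Vec d) (volume : Measure (Torus d)) (p := 2) ℂ (by simp)
  refine closure_minimal ?_ (Submodule.isClosed_topologicalClosure _) (hd u)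
  rintro _ ⟨g, rfl⟩
  rw [toLp_eq_sum_tensor]
  exact Submodule.sum_mem _ fun i _ => tensor_mem_closure _ _

/-! ### Fourier coefficients -/

lemma coeff_eq (f : Torus d → Vec d) (k : Fin d → ℤ) :
    coeff f k = (((2 * Real.pi) ^ d)⁻¹ : ℝ) • ∫ x : Torus d, character (-k) x • f x := rfl

/-- The Fourier coefficient as a continuous linear map on `L²`. -/
def coeffL (k : Fin d → ℤ) : L2 d →L[ℂ] Vec d :=
  ((((2 * Real.pi) ^ d)⁻¹ : ℝ) : ℂ) •
    ContinuousLinearMap.lpPairing volume 2 2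
      (ContinuousLinearMap.lsmul ℂ ℂ : ℂ →L[ℂ] Vec d →L[ℂ] Vec d)
      (ContinuousMap.toLp 2 (volume : Measure (Torus d)) ℂ (character (-k)))

lemma coeffL_apply (k : Fin d → ℤ) (u : L2 d) : coeffL k u = coeff u k := by
  rw [coeffL, smul_apply, ContinuousLinearMap.lpPairing_eq_integral, coeff_eq,
    Complex.coe_smul]
  congr 1
  apply integral_congr_ae
  filter_upwards [ContinuousMap.coeFn_toLp (p := 2) (𝕜 := ℂ) volume (character (-k))] with x hx
  rw [hx]
  rfl

lemma coeff_tensor (k l : Fin d → ℤ) (a : Vec d) :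
    coeff (tensor a (character l)) k = if l = k then a else 0 := by
  rw [coeff_eq]
  have : ∀ᵐ x : Torus d, character (-k) x • (tensor a (character l)) x =
      character (l - k) x • a := by
    filter_upwards [coeFn_tensor a (character l)] with x h1
    rw [h1, smul_smul, sub_eq_add_neg, character_add, mul_comm]
  rw [integral_congr_ae this, integral_smul_const, integral_character]
  have := (pow_pos Real.two_pi_pos d).ne'
  simp only [sub_eq_zero]
  split_ifs
  · rw [Complex.coe_smul, smul_smul, inv_mul_cancel₀ this, one_smul]
  · simp

/-- `L²` fields are square summable families of Fourier modes. -/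
def fourierEquiv (d : ℕ) : L2 d ≃ₗᵢ[ℂ] lp (fun _ : Fin d → ℤ => Vec d) 2 :=
  isHilbertSum_modeIsometry.linearIsometryEquiv

lemma coeff_modeIsometry (k l : Fin d → ℤ) (a : Vec d) :
    coeff (modeIsometry l a) k = if l = k then ((volSqrt d)⁻¹ : ℂ) • a else 0 := by
  rw [modeIsometry_apply, ← coeffL_apply, map_smul, coeffL_apply, coeff_tensor]
  split_ifs <;> simp

lemma hasSum_modeIsometry (u : L2 d) :
    HasSum (fun k => modeIsometry k (fourierEquiv d u k)) u := by
  simpa [fourierEquiv] using!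
    isHilbertSum_modeIsometry.hasSum_linearIsometryEquiv_symm (fourierEquiv d u)

lemma coeff_eq_fourierEquiv (u : L2 d) (k : Fin d → ℤ) :
    coeff u k = ((volSqrt d)⁻¹ : ℂ) • fourierEquiv d u k := by
  have h := (hasSum_modeIsometry u).mapL (coeffL k)
  simp only [coeffL_apply, coeff_modeIsometry] at h
  refine h.unique ?_
  convert! hasSum_ite_eq k (((volSqrt d)⁻¹ : ℂ) • fourierEquiv d u k) using 2 with l
  split_ifs with hl
  · rw [hl]
  · rfl

lemma hasSum_tensor_coeff (u : L2 d) :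
    HasSum (fun k => tensor (coeff u k) (character k)) u := by
  convert hasSum_modeIsometry u using 2 with k
  rw [coeff_eq_fourierEquiv]
  have h0 : (volSqrt d : ℂ) ≠ 0 := by exact_mod_cast (volSqrt_pos d).ne'
  have : fourierEquiv d u k = (volSqrt d : ℂ) • (((volSqrt d)⁻¹ : ℂ) • fourierEquiv d u k) := by
    rw [smul_smul, mul_inv_cancel₀ h0, one_smul]
  conv_rhs => rw [this, map_smul, modeIsometry_apply, smul_smul, mul_inv_cancel₀ h0, one_smul]

lemma ext_coeff {u v : L2 d} (h : ∀ k : Fin d → ℤ, coeff u k = coeff v k) : u = v := by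
  refine (hasSum_tensor_coeff u).unique ?_
  simp only [h]
  exact hasSum_tensor_coeff v

/-- Parseval's identity. -/
lemma hasSum_norm_coeff_sq (u : L2 d) :
    HasSum (fun k : Fin d → ℤ => ‖coeff u k‖ ^ 2) (((2 * Real.pi) ^ d)⁻¹ * ‖u‖ ^ 2) := by
  have h := lp.hasSum_norm (p := 2) (by norm_num) (fourierEquiv d u)
  simp only [ENNReal.toReal_ofNat, Real.rpow_ofNat, LinearIsometryEquiv.norm_map] at h
  refine (h.mul_left (((2 * Real.pi) ^ d)⁻¹)).congr_fun fun k => ?_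
  rw [coeff_eq_fourierEquiv, norm_smul, mul_pow, ← volSqrt_sq]
  simp [abs_of_pos (volSqrt_pos d)]

/-- Riesz-Fischer. -/
lemma exists_coeff_eq {a : (Fin d → ℤ) → Vec d} (ha : Summable fun k => ‖a k‖ ^ 2) :
    ∃ u : L2 d, ∀ k : Fin d → ℤ, coeff u k = a k := by
  have hm : Memℓp (fun k => (volSqrt d : ℂ) • a k) 2 := by
    refine (memℓp_gen ?_)
    simp only [ENNReal.toReal_ofNat, Real.rpow_ofNat, norm_smul, mul_pow]
    exact ha.mul_left _
  refine ⟨(fourierEquiv d).symm ⟨_, hm⟩, fun k => ?_⟩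
  have h0 : (volSqrt d : ℂ) ≠ 0 := by exact_mod_cast (volSqrt_pos d).ne'
  rw [coeff_eq_fourierEquiv, LinearIsometryEquiv.apply_symm_apply, smul_smul,
    inv_mul_cancel₀ h0, one_smul]

/-! ### Products -/

/-- The bilinear map `(v, w) ↦ v_j w` on `ℂᵈ`. -/
def coordSmul (j : Fin d) : Vec d →L[ℂ] Vec d →L[ℂ] Vec d :=
  (ContinuousLinearMap.lsmul ℂ ℂ).comp (EuclideanSpace.proj j : Vec d →L[ℂ] ℂ)

/-- The Fourier coefficient of `u_j v` as a continuous bilinear map of `u`, `v` in `L²`. -/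
def coeffMulL (j : Fin d) (k : Fin d → ℤ) : L2 d →L[ℂ] L2 d →L[ℂ] Vec d :=
  -- Hölder is used twice: `L∞ · L² ⊆ L²` puts the character on `v`, then `L² · L² ⊆ L¹` pairs with
  -- `u_j`.
  (((((2 * Real.pi) ^ d)⁻¹ : ℝ) : ℂ) •
    ((coordSmul j).lpPairing (volume : Measure (Torus d)) 2 2).flip.comp
      ((ContinuousLinearMap.lsmul ℂ ℂ : ℂ →L[ℂ] Vec d →L[ℂ] Vec d).holderL volume ∞ 2 2
        (ContinuousMap.toLp ∞ (volume : Measure (Torus d)) ℂ (character (-k))))).flip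

lemma coeffMulL_apply (j : Fin d) (k : Fin d → ℤ) (u v : L2 d) :
    coeffMulL j k u v = coeff (fun x => u x j • v x) k := by
  rw [coeff_eq]
  simp only [coeffMulL, ContinuousLinearMap.flip_apply, smul_apply,
    ContinuousLinearMap.comp_apply, ContinuousLinearMap.holderL_apply_apply,
    ContinuousLinearMap.lpPairing_eq_integral, Complex.coe_smul]
  congr 1
  apply integral_congr_ae
  filter_upwards [ContinuousMap.coeFn_toLp (p := ∞) (𝕜 := ℂ) volume (character (-k)),
    ContinuousLinearMap.coeFn_holder (r := 2)
      (ContinuousLinearMap.lsmul ℂ ℂ : ℂ →L[ℂ] Vec d →L[ℂ] Vec d)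
      (ContinuousMap.toLp ∞ (volume : Measure (Torus d)) ℂ (character (-k))) v] with x h1 h2
  rw [h2, h1]
  exact smul_comm (u x j) (character (-k) x) (v x)

lemma coeffMulL_tensor (j : Fin d) (k l : Fin d → ℤ) (a : Vec d) (v : L2 d) :
    coeffMulL j k (tensor a (character l)) v = a j • coeff v (k - l) := by
  rw [coeffMulL_apply, coeff_eq, coeff_eq, smul_comm, ← integral_smul (a j)]
  congr 1
  apply integral_congr_ae
  filter_upwards [coeFn_tensor a (character l)] with x h1
  rw [h1, neg_sub, sub_eq_add_neg, character_add]
  simp only [PiLp.smul_apply, smul_eq_mul, smul_smul]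
  ring_nf

/-- The Fourier coefficients of a product are given by convolution. -/
lemma hasSum_coeffMulL (j : Fin d) (k : Fin d → ℤ) (u v : L2 d) :
    HasSum (fun l => coeff u l j • coeff v (k - l)) (coeffMulL j k u v) := by
  -- By continuity it suffices to expand `u` alone: against one mode of `u`, the form just reads off
  -- a shifted coefficient of `v`.
  have h := ((hasSum_tensor_coeff u).mapL (coeffMulL j k)).mapL
    (ContinuousLinearMap.apply ℂ (Vec d) v)
  simpa only [ContinuousLinearMap.apply_apply, coeffMulL_tensor] using h

/-- The symbol of the Leray projection as a linear map. -/
def lerayₗ (k : Fin d → ℤ) : Vec d →ₗ[ℂ] Vec d where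
  toFun := leray k
  map_add' v w := by
    ext i
    simp only [leray, PiLp.add_apply, mul_add, Finset.sum_add_distrib]
    ring
  map_smul' c v := by
    ext i
    simp only [leray, PiLp.smul_apply, smul_eq_mul, RingHom.id_apply, mul_left_comm _ c,
      ← Finset.mul_sum]
    ring

/-- The Fourier coefficient of `B(u, v)` as a continuous bilinear map. -/
def eulerBL (k : Fin d → ℤ) : L2 d →L[ℂ] L2 d →L[ℂ] Vec d :=
  (ContinuousLinearMap.compL ℂ (L2 d) (Vec d) (Vec d) (lerayₗ k).toContinuousLinearMap).comp
    (∑ j, (Complex.I * (k j : ℂ)) • coeffMulL j k)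

lemma eulerBL_apply (k : Fin d → ℤ) (u v : L2 d) : eulerBL k u v = eulerBCoeff u v k := by
  simp only [eulerBL, ContinuousLinearMap.comp_apply, ContinuousLinearMap.compL_apply,
    sum_apply, smul_apply, coeffMulL_apply]
  rfl

/-- The Euler nonlinearity on sequences of Fourier coefficients. -/
def convB (a b : (Fin d → ℤ) → Vec d) (k : Fin d → ℤ) : Vec d :=
  leray k (∑ j, (Complex.I * (k j : ℂ)) • ∑' l, a l j • b (k - l))

lemma eulerBCoeff_eq_convB (u v : L2 d) (k : Fin d → ℤ) :
    eulerBCoeff u v k = convB (coeff u) (coeff v) k := by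
  simp only [eulerBCoeff, divTensorCoeff, ← coeffMulL_apply, convB,
    (hasSum_coeffMulL _ k u v).tsum_eq]

/-! ### The extended `ℓ²` norm -/

section Ell2

variable {ι : Type*}

/-- The `ℓ²` norm of a family in `[0, ∞]`. -/
def ell2 (f : ι → ℝ≥0∞) : ℝ≥0∞ := (∑' k, f k ^ 2) ^ (1 / 2 : ℝ)

lemma ell2_sq (f : ι → ℝ≥0∞) : ell2 f ^ 2 = ∑' k, f k ^ 2 := by
  rw [ell2, ← ENNReal.rpow_two, ← ENNReal.rpow_mul]
  norm_num

lemma ell2_le_iff {f : ι → ℝ≥0∞} {c : ℝ≥0∞} : ell2 f ≤ c ↔ ∑' k, f k ^ 2 ≤ c ^ 2 := by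
  rw [← ell2_sq, ENNReal.pow_le_pow_left_iff two_ne_zero]

lemma ell2_mono {f g : ι → ℝ≥0∞} (h : ∀ k, f k ≤ g k) : ell2 f ≤ ell2 g :=
  ENNReal.rpow_le_rpow (ENNReal.tsum_le_tsum fun k => pow_le_pow_left' (h k) 2) (by norm_num)

lemma ell2_const_mul (c : ℝ≥0∞) (f : ι → ℝ≥0∞) : ell2 (fun k => c * f k) = c * ell2 f := by
  simp only [ell2, mul_pow, ENNReal.tsum_mul_left]
  rw [ENNReal.mul_rpow_of_nonneg _ _ (by norm_num), ← ENNReal.rpow_two, ← ENNReal.rpow_mul]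
  norm_num

lemma le_ell2 (f : ι → ℝ≥0∞) (k : ι) : f k ≤ ell2 f := by
  rw [← ENNReal.pow_le_pow_left_iff two_ne_zero, ell2_sq]
  exact ENNReal.le_tsum k

lemma ell2_add_le (f g : ι → ℝ≥0∞) : ell2 (fun k => f k + g k) ≤ ell2 f + ell2 g := by
  -- With every set measurable, sums are integrals against counting measure and Minkowski applies.
  let _ : MeasurableSpace ι := ⊤
  have h := ENNReal.lintegral_Lp_add_le (μ := Measure.count) (p := 2) (f := f) (g := g)
    (measurable_from_top).aemeasurable (measurable_from_top).aemeasurable one_le_two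
  simpa only [ell2, lintegral_count, ENNReal.rpow_two, Pi.add_apply] using h

lemma ell2_sum_le {α : Type*} (s : Finset α) (f : α → ι → ℝ≥0∞) :
    ell2 (fun k => ∑ i ∈ s, f i k) ≤ ∑ i ∈ s, ell2 (f i) := by
  classical
  induction s using Finset.induction_on with
  | empty => simp [ell2]
  | insert a s ha ih =>
    simp only [Finset.sum_insert ha]
    exact (ell2_add_le _ _).trans (add_le_add le_rfl ih)

lemma tsum_mul_le_ell2_mul_ell2 (f g : ι → ℝ≥0∞) : ∑' k, f k * g k ≤ ell2 f * ell2 g := by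
  let _ : MeasurableSpace ι := ⊤
  have h := ENNReal.lintegral_mul_le_Lp_mul_Lq Measure.count (p := 2) (q := 2) (f := f) (g := g)
    (by rw [Real.holderConjugate_iff]; norm_num)
    (measurable_from_top).aemeasurable (measurable_from_top).aemeasurable
  simpa only [ell2, lintegral_count, ENNReal.rpow_two, Pi.mul_apply] using h

variable [AddCommGroup ι]

lemma tsum_conv_comm (f g : ι → ℝ≥0∞) (k : ι) :
    ∑' l, f l * g (k - l) = ∑' l, g l * f (k - l) := by
  rw [← (Equiv.subLeft k).tsum_eq]
  simp [mul_comm]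

/-- Young's inequality `ℓ² * ℓ¹ ⊆ ℓ²`. -/
lemma ell2_conv_le (f g : ι → ℝ≥0∞) :
    ell2 (fun k => ∑' l, f l * g (k - l)) ≤ ell2 f * ∑' k, g k := by
  rw [ell2_le_iff, mul_pow, ell2_sq]
  have hrt : ∀ x : ℝ≥0∞, (x ^ (1 / 2 : ℝ)) ^ 2 = x := fun x => by
    rw [← ENNReal.rpow_two, ← ENNReal.rpow_mul]
    norm_num
  -- Cauchy-Schwarz after the splitting `f g = (f √g) · √g`.
  have hpt : ∀ k, (∑' l, f l * g (k - l)) ^ 2 ≤ (∑' l, f l ^ 2 * g (k - l)) * ∑' l, g l := by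
    intro k
    have h := tsum_mul_le_ell2_mul_ell2 (fun l => f l * g (k - l) ^ (1 / 2 : ℝ))
      (fun l => g (k - l) ^ (1 / 2 : ℝ))
    have h2 := pow_le_pow_left' h 2
    rw [mul_pow, ell2_sq, ell2_sq] at h2
    simp only [mul_pow, hrt, mul_assoc, ← sq] at h2
    have h3 : ∑' l, g (k - l) = ∑' l, g l := (Equiv.subLeft k).tsum_eq g
    rwa [h3] at h2
  calc ∑' k, (∑' l, f l * g (k - l)) ^ 2
      ≤ ∑' k, (∑' l, f l ^ 2 * g (k - l)) * ∑' l, g l := ENNReal.tsum_le_tsum hpt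
    _ = (∑' l, f l ^ 2 * ∑' k, g (k - l)) * ∑' l, g l := by
        rw [ENNReal.tsum_mul_right, ENNReal.tsum_comm]
        simp only [ENNReal.tsum_mul_left]
    _ = (∑' k, f k ^ 2) * (∑' k, g k) ^ 2 := by
        have : ∀ l, ∑' k, g (k - l) = ∑' k, g k := fun l => (Equiv.subRight l).tsum_eq g
        simp only [this, ENNReal.tsum_mul_right]
        rw [mul_assoc, sq]

end Ell2

/-! ### Wave vectors and Gevrey weights -/

lemma waveLength_eq_norm (k : Fin d → ℤ) :
    waveLength k = ‖(WithLp.toLp 2 fun j => (k j : ℝ) : EuclideanSpace ℝ (Fin d))‖ := by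
  simp [waveLength, EuclideanSpace.norm_eq]

lemma waveLength_nonneg (k : Fin d → ℤ) : 0 ≤ waveLength k := Real.sqrt_nonneg _

lemma waveLength_sq (k : Fin d → ℤ) : waveLength k ^ 2 = ∑ j, (k j : ℝ) ^ 2 :=
  Real.sq_sqrt (Finset.sum_nonneg fun _ _ => sq_nonneg _)

lemma waveLength_add_le (k l : Fin d → ℤ) : waveLength (k + l) ≤ waveLength k + waveLength l := by
  simp only [waveLength_eq_norm]
  refine le_trans (le_of_eq ?_) (norm_add_le _ _)
  congr 1
  ext j
  simp

lemma abs_le_waveLength (k : Fin d → ℤ) (j : Fin d) : |(k j : ℝ)| ≤ waveLength k := by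
  rw [waveLength_eq_norm]
  exact PiLp.norm_apply_le (WithLp.toLp 2 fun j => (k j : ℝ) : EuclideanSpace ℝ (Fin d)) j

lemma one_le_waveLength {k : Fin d → ℤ} (hk : k ≠ 0) : 1 ≤ waveLength k := by
  obtain ⟨j, hj⟩ := Function.ne_iff.mp hk
  refine le_trans ?_ (abs_le_waveLength k j)
  exact_mod_cast Int.one_le_abs hj

/-- The weight `|k|^r e^{β|k|}`. -/
def gevreyWeight (r β : ℝ) (k : Fin d → ℤ) : ℝ≥0∞ :=
  ENNReal.ofReal (waveLength k ^ r * Real.exp (β * waveLength k))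

lemma gevreyWeight_mono {r β β' : ℝ} (h : β ≤ β') (k : Fin d → ℤ) :
    gevreyWeight r β k ≤ gevreyWeight r β' k := by
  have := waveLength_nonneg k
  unfold gevreyWeight
  gcongr

lemma one_le_gevreyWeight {r β : ℝ} (hr : 0 ≤ r) (hβ : 0 ≤ β) {k : Fin d → ℤ} (hk : k ≠ 0) :
    1 ≤ gevreyWeight r β k := by
  rw [gevreyWeight, ENNReal.one_le_ofReal]
  exact one_le_mul_of_one_le_of_one_le (Real.one_le_rpow (one_le_waveLength hk) hr)
    (Real.one_le_exp (mul_nonneg hβ (waveLength_nonneg k)))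

/-- A derivative is controlled by enlarging the Gevrey radius. -/
lemma waveLength_mul_gevreyWeight_le {r β η : ℝ} (hη : 0 < η) (k : Fin d → ℤ) :
    ENNReal.ofReal (waveLength k) * gevreyWeight r β k ≤
      ENNReal.ofReal (1 / (Real.exp 1 * η)) * gevreyWeight r (β + η) k := by
  have h0 := waveLength_nonneg k
  rw [gevreyWeight, gevreyWeight, ← ENNReal.ofReal_mul h0, ← ENNReal.ofReal_mul (by positivity)]
  apply ENNReal.ofReal_le_ofReal
  -- This is `et ≤ e^t` at `t = η|k|`: the maximum of `t ↦ t e^{-ηt}` is `1/(eη)`.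
  have h1 := Real.add_one_le_exp (η * waveLength k - 1)
  have h2 : waveLength k ≤ 1 / (Real.exp 1 * η) * Real.exp (η * waveLength k) := by
    rw [Real.exp_sub] at h1
    have he := Real.exp_pos 1
    rw [div_mul_eq_mul_div, one_mul, le_div_iff₀ (by positivity)]
    rw [sub_add_cancel, le_div_iff₀ he] at h1
    linarith
  have h3 : 0 ≤ waveLength k ^ r := Real.rpow_nonneg h0 r
  rw [add_mul, Real.exp_add]
  calc waveLength k * (waveLength k ^ r * Real.exp (β * waveLength k))
      ≤ (1 / (Real.exp 1 * η) * Real.exp (η * waveLength k)) *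
        (waveLength k ^ r * Real.exp (β * waveLength k)) := by gcongr
    _ = _ := by ring

/-- From `x + y ≤ 2 max x y`; this is the origin of the factor `2^r` in the radius. -/
lemma add_rpow_le_two_rpow {x y r : ℝ} (hx : 0 ≤ x) (hy : 0 ≤ y) (hr : 0 ≤ r) :
    (x + y) ^ r ≤ 2 ^ r * (x ^ r + y ^ r) := by
  have h1 : (x + y) ^ r ≤ (2 * max x y) ^ r := by
    apply Real.rpow_le_rpow (by positivity) _ hr
    linarith [le_max_left x y, le_max_right x y]
  rw [Real.mul_rpow zero_le_two (le_max_of_le_left hx)] at h1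
  refine h1.trans (mul_le_mul_of_nonneg_left ?_ (by positivity))
  have hx' := Real.rpow_nonneg hx r
  have hy' := Real.rpow_nonneg hy r
  rcases max_choice x y with h | h <;> rw [h] <;> linarith

/-- `e^{β|k|}`. -/
def expWeight (β : ℝ) (k : Fin d → ℤ) : ℝ≥0∞ := ENNReal.ofReal (Real.exp (β * waveLength k))

/-- In each product only one factor keeps the power `|·|^r`; the other has the bare exponential
weight and can therefore be measured in `ℓ¹`. -/
lemma gevreyWeight_add_le {r β : ℝ} (hr : 0 ≤ r) (hβ : 0 ≤ β) (k l : Fin d → ℤ) :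
    gevreyWeight r β (k + l) ≤ ENNReal.ofReal (2 ^ r) *
      (gevreyWeight r β k * expWeight β l + expWeight β k * gevreyWeight r β l) := by
  have hk := waveLength_nonneg k
  have hl := waveLength_nonneg l
  have hk' := Real.rpow_nonneg hk r
  have hl' := Real.rpow_nonneg hl r
  simp only [gevreyWeight, expWeight]
  rw [← ENNReal.ofReal_mul (by positivity), ← ENNReal.ofReal_mul (by positivity),
    ← ENNReal.ofReal_add (by positivity) (by positivity), ← ENNReal.ofReal_mul (by positivity)]
  apply ENNReal.ofReal_le_ofReal
  calc waveLength (k + l) ^ r * Real.exp (β * waveLength (k + l))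
      ≤ (2 ^ r * (waveLength k ^ r + waveLength l ^ r)) *
        Real.exp (β * (waveLength k + waveLength l)) := by
        have h1 := waveLength_add_le k l
        refine mul_le_mul ?_ (by gcongr) (by positivity) (by positivity)
        exact (Real.rpow_le_rpow (waveLength_nonneg _) h1 hr).trans (add_rpow_le_two_rpow hk hl hr)
    _ = _ := by rw [mul_add β, Real.exp_add]; ring

/-- `|k|^{-(d+1)/2}`. -/
def decayWeight (k : Fin d → ℤ) : ℝ≥0∞ :=
  ENNReal.ofReal (waveLength k ^ (-(((d : ℝ) + 1) / 2)))

/-- Since `|k| ≥ 1`, the surplus power `r - (d+1)/2` is discarded, so the lattice sum does not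
depend on `r`. At `k = 0` the right side vanishes, hence the condition on `g`. -/
lemma expWeight_mul_le {r β : ℝ} (hr : ((d : ℝ) + 1) / 2 ≤ r) {g : (Fin d → ℤ) → ℝ≥0∞}
    (hg : g 0 = 0) (k : Fin d → ℤ) :
    expWeight β k * g k ≤ decayWeight k * (gevreyWeight r β k * g k) := by
  by_cases hk : k = 0
  · simp [hk, hg]
  rw [← mul_assoc]
  gcongr
  have h1 := one_le_waveLength hk
  have h0 : 0 < waveLength k := by linarith
  rw [expWeight, decayWeight, gevreyWeight, ← ENNReal.ofReal_mul (by positivity)]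
  apply ENNReal.ofReal_le_ofReal
  rw [← mul_assoc, ← Real.rpow_add h0]
  exact le_mul_of_one_le_left (Real.exp_pos _).le (Real.one_le_rpow h1 (by linarith))

/-- The lattice sum `(∑_{k ≠ 0} |k|^{-(d+1)})^{1/2}`. -/
def latticeConst (d : ℕ) : ℝ≥0∞ := ell2 (decayWeight (d := d))

/-- Young's inequality bounds each half by an `ℓ²` norm times an exponentially weighted `ℓ¹` norm;
Cauchy-Schwarz against `decayWeight` bounds the latter by the Gevrey norm. -/
lemma ell2_gevreyWeight_conv_le {r β : ℝ} (hr : ((d : ℝ) + 1) / 2 ≤ r) (hβ : 0 ≤ β)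
    {f g : (Fin d → ℤ) → ℝ≥0∞} (hf : f 0 = 0) (hg : g 0 = 0) :
    ell2 (fun k => gevreyWeight r β k * ∑' l, f l * g (k - l)) ≤
      ENNReal.ofReal (2 ^ r) * (2 * latticeConst d) *
        (ell2 (fun k => gevreyWeight r β k * f k) * ell2 (fun k => gevreyWeight r β k * g k)) := by
  have hr0 : 0 ≤ r := le_trans (by positivity) hr
  set F := fun k => gevreyWeight r β k * f k
  set G := fun k => gevreyWeight r β k * g k
  have hwiener : ∀ h : (Fin d → ℤ) → ℝ≥0∞, h 0 = 0 → ∑' k, expWeight β k * h k ≤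
      latticeConst d * ell2 (fun k => gevreyWeight r β k * h k) := fun h h0 =>
    (ENNReal.tsum_le_tsum fun k => expWeight_mul_le hr h0 k).trans
      (tsum_mul_le_ell2_mul_ell2 _ _)
  have hpt : ∀ k, gevreyWeight r β k * ∑' l, f l * g (k - l) ≤
      ENNReal.ofReal (2 ^ r) * ((∑' l, F l * (expWeight β (k - l) * g (k - l))) +
        ∑' l, G l * (expWeight β (k - l) * f (k - l))) := by
    intro k
    rw [tsum_conv_comm G (fun l => expWeight β l * f l), ← ENNReal.tsum_add,
      ← ENNReal.tsum_mul_left, ← ENNReal.tsum_mul_left]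
    refine ENNReal.tsum_le_tsum fun l => ?_
    have h := gevreyWeight_add_le hr0 hβ l (k - l)
    rw [add_sub_cancel] at h
    calc gevreyWeight r β k * (f l * g (k - l)) ≤ _ := mul_le_mul_left h _
      _ = _ := by simp only [F, G]; ring
  refine (ell2_mono hpt).trans ?_
  rw [ell2_const_mul, mul_assoc]
  gcongr
  refine (ell2_add_le _ _).trans ?_
  calc _ ≤ ell2 F * (latticeConst d * ell2 G) + ell2 G * (latticeConst d * ell2 F) := by
        refine add_le_add ((ell2_conv_le F (fun l => expWeight β l * g l)).trans ?_)
          ((ell2_conv_le G (fun l => expWeight β l * f l)).trans ?_)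
        · gcongr
          exact hwiener g hg
        · gcongr
          exact hwiener f hf
    _ = 2 * latticeConst d * (ell2 F * ell2 G) := by ring

/-- The squared weights are `|k|^{-(d+1)}`, and `d + 1` exceeds the rank of the lattice. The term at
`k = 0` is `0` by the convention for real powers of zero. -/
lemma latticeConst_lt_top (d : ℕ) : latticeConst d < ∞ := by
  have hL : Summable fun k : Fin d → ℤ => waveLength k ^ (-((d : ℝ) + 1)) := by
    let b := (EuclideanSpace.basisFun (Fin d) ℝ).toBasis
    let L := Submodule.span ℤ (Set.range b)
    have hfin : Module.finrank ℤ L = d := by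
      rw [ZLattice.rank ℝ L]
      simp
    have hs := ZLattice.summable_norm_rpow L (-((d : ℝ) + 1)) (by rw [hfin]; linarith)
    have hmem : ∀ k : Fin d → ℤ,
        (WithLp.toLp 2 fun j => (k j : ℝ) : EuclideanSpace ℝ (Fin d)) ∈ L := by
      intro k
      have : (WithLp.toLp 2 fun j => (k j : ℝ) : EuclideanSpace ℝ (Fin d)) = ∑ j, k j • b j := by
        ext i
        simp [b, Pi.single_apply]
      rw [this]
      exact Submodule.sum_mem _ fun j _ =>
        Submodule.smul_mem _ _ (Submodule.subset_span ⟨j, rfl⟩)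
    have hinj : Function.Injective (fun k : Fin d → ℤ =>
        (⟨WithLp.toLp 2 fun j => (k j : ℝ), hmem k⟩ : L)) := by
      intro k l h
      ext j
      have := congrArg (fun v : L => (v : EuclideanSpace ℝ (Fin d)) j) h
      simpa using this
    refine (hs.comp_injective hinj).congr fun k => ?_
    simp [waveLength_eq_norm]
  refine ENNReal.rpow_lt_top_of_nonneg (by norm_num) ?_
  have : ∀ k : Fin d → ℤ, decayWeight k ^ 2 = ENNReal.ofReal (waveLength k ^ (-((d : ℝ) + 1))) := by
    intro k
    rw [decayWeight, ← ENNReal.ofReal_pow (Real.rpow_nonneg (waveLength_nonneg k) _),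
      ← Real.rpow_mul_natCast (waveLength_nonneg k)]
    congr 2
    push_cast
    ring
  simp only [this]
  exact hL.tsum_ofReal_ne_top

/-! ### Bounds for the Euler nonlinearity -/

/-- The triangle inequality and Cauchy-Schwarz suffice: the sharp constant `1` is not needed, as `C`
absorbs the loss. -/
lemma norm_leray_le (k : Fin d → ℤ) (w : Vec d) : ‖leray k w‖ ≤ 2 * ‖w‖ := by
  set κ : Vec d := WithLp.toLp 2 fun j => (k j : ℂ)
  have hκ : ‖κ‖ = waveLength k := by
    simp [κ, EuclideanSpace.norm_eq, waveLength]
  have hin : ∑ j, (k j : ℂ) * w j = inner ℂ κ w := by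
    simp [κ, PiLp.inner_apply, mul_comm]
  have hsq : ∑ j, (k j : ℂ) ^ 2 = ((waveLength k ^ 2 : ℝ) : ℂ) := by
    rw [waveLength_sq]
    push_cast
    rfl
  have hl : leray k w = w - (inner ℂ κ w / ((waveLength k ^ 2 : ℝ) : ℂ)) • κ := by
    ext i
    simp only [leray, hin, hsq, κ, PiLp.sub_apply, PiLp.smul_apply, smul_eq_mul]
  rw [hl, two_mul]
  refine (norm_sub_le _ _).trans (add_le_add le_rfl ?_)
  rw [norm_smul, norm_div, Complex.norm_real, hκ, Real.norm_of_nonneg (sq_nonneg _)]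
  have h1 := norm_inner_le_norm (𝕜 := ℂ) κ w
  rw [hκ] at h1
  rcases (waveLength_nonneg k).eq_or_lt with h0 | h0
  · simp [← h0]
  · rw [div_mul_eq_mul_div, div_le_iff₀ (by positivity)]
    nlinarith

lemma enorm_convB_le (a b : (Fin d → ℤ) → Vec d) (k : Fin d → ℤ) :
    ‖convB a b k‖ₑ ≤ 2 * d * (ENNReal.ofReal (waveLength k) * ∑' l, ‖a l‖ₑ * ‖b (k - l)‖ₑ) := by
  set T := ∑' l, ‖a l‖ₑ * ‖b (k - l)‖ₑ
  have h1 : ∀ w : Vec d, ‖leray k w‖ₑ ≤ 2 * ‖w‖ₑ := by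
    intro w
    have := ENNReal.ofReal_le_ofReal (norm_leray_le k w)
    rwa [ENNReal.ofReal_mul zero_le_two, ofReal_norm, ofReal_norm, ENNReal.ofReal_ofNat] at this
  have h2 : ∀ j, ‖(Complex.I * (k j : ℂ)) • ∑' l, a l j • b (k - l)‖ₑ ≤
      ENNReal.ofReal (waveLength k) * T := by
    intro j
    rw [enorm_smul]
    refine mul_le_mul' ?_ (enorm_tsum_le_tsum_enorm.trans (ENNReal.tsum_le_tsum fun l => ?_))
    · rw [← ofReal_norm]
      apply ENNReal.ofReal_le_ofReal
      simpa using abs_le_waveLength k j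
    · rw [enorm_smul]
      gcongr
      rw [← ofReal_norm, ← ofReal_norm]
      exact ENNReal.ofReal_le_ofReal (PiLp.norm_apply_le (a l) j)
  refine (h1 _).trans ?_
  rw [mul_assoc]
  gcongr
  refine (enorm_sum_le _ _).trans ((Finset.sum_le_sum fun j _ => h2 j).trans ?_)
  simp

/-- The nonlinearity is bounded between Gevrey classes, with a loss of radius `η`. -/
lemma ell2_gevreyWeight_convB_le {r β η : ℝ} (hr : ((d : ℝ) + 1) / 2 ≤ r) (hβ : 0 ≤ β)
    (hη : 0 < η) {a b : (Fin d → ℤ) → Vec d} (ha : a 0 = 0) (hb : b 0 = 0) :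
    ell2 (fun k => gevreyWeight r β k * ‖convB a b k‖ₑ) ≤
      4 * d * (ENNReal.ofReal (2 ^ r) * latticeConst d) * ENNReal.ofReal (1 / (Real.exp 1 * η)) *
        (ell2 (fun k => gevreyWeight r (β + η) k * ‖a k‖ₑ) *
          ell2 (fun k => gevreyWeight r (β + η) k * ‖b k‖ₑ)) := by
  have hpt : ∀ k, gevreyWeight r β k * ‖convB a b k‖ₑ ≤
      (2 * d * ENNReal.ofReal (1 / (Real.exp 1 * η))) *
        (gevreyWeight r (β + η) k * ∑' l, ‖a l‖ₑ * ‖b (k - l)‖ₑ) := by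
    intro k
    calc gevreyWeight r β k * ‖convB a b k‖ₑ
        ≤ gevreyWeight r β k *
          (2 * d * (ENNReal.ofReal (waveLength k) * ∑' l, ‖a l‖ₑ * ‖b (k - l)‖ₑ)) := by
          gcongr
          exact enorm_convB_le a b k
      _ = 2 * d * ((ENNReal.ofReal (waveLength k) * gevreyWeight r β k) *
          ∑' l, ‖a l‖ₑ * ‖b (k - l)‖ₑ) := by ring
      _ ≤ 2 * d * ((ENNReal.ofReal (1 / (Real.exp 1 * η)) * gevreyWeight r (β + η) k) *
          ∑' l, ‖a l‖ₑ * ‖b (k - l)‖ₑ) := by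
          exact mul_le_mul_right (mul_le_mul_left (waveLength_mul_gevreyWeight_le hη k) _) _
      _ = _ := by ring
  refine (ell2_mono hpt).trans ?_
  rw [ell2_const_mul]
  calc _ ≤ (2 * d * ENNReal.ofReal (1 / (Real.exp 1 * η))) *
        (ENNReal.ofReal (2 ^ r) * (2 * latticeConst d) *
          (ell2 (fun k => gevreyWeight r (β + η) k * ‖a k‖ₑ) *
            ell2 (fun k => gevreyWeight r (β + η) k * ‖b k‖ₑ))) := by
        gcongr
        exact ell2_gevreyWeight_conv_le hr (by linarith) (by simp [ha]) (by simp [hb])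
    _ = _ := by ring

/-! ### The formal power series solution -/

/-- Fourier coefficients of the Taylor coefficients of the solution with initial Fourier
coefficients `a`. -/
def taylorCoeff (a : (Fin d → ℤ) → Vec d) : ℕ → (Fin d → ℤ) → Vec d
  | 0 => a
  | n + 1 => fun k => (-((n : ℂ) + 1)⁻¹) •
      ∑ i : Fin (n + 1), convB (taylorCoeff a i) (taylorCoeff a (n - i)) k

lemma taylorCoeff_zero (a : (Fin d → ℤ) → Vec d) : taylorCoeff a 0 = a := by rw [taylorCoeff]

lemma taylorCoeff_succ (a : (Fin d → ℤ) → Vec d) (n : ℕ) (k : Fin d → ℤ) :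
    taylorCoeff a (n + 1) k = (-((n : ℂ) + 1)⁻¹) •
      ∑ p ∈ Finset.HasAntidiagonal.antidiagonal n,
        convB (taylorCoeff a p.1) (taylorCoeff a p.2) k := by
  rw [taylorCoeff, Finset.Nat.sum_antidiagonal_eq_sum_range_succ_mk,
    Finset.sum_range (fun i => convB (taylorCoeff a i) (taylorCoeff a (n - i)) k)]

lemma leray_zero (k : Fin d → ℤ) : leray k 0 = 0 := (lerayₗ k).map_zero

/-- The factor `i k_j` does the work: by the convention `x / 0 = 0`, the symbol `leray` is the
identity at `k = 0`. -/
lemma convB_zero (a b : (Fin d → ℤ) → Vec d) : convB a b 0 = 0 := by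
  simp [convB, leray_zero]

lemma sum_mul_leray (k : Fin d → ℤ) (w : Vec d) : ∑ j, (k j : ℂ) * leray k w j = 0 := by
  by_cases hk : k = 0
  · simp [hk]
  have hq : ∑ j, (k j : ℂ) ^ 2 ≠ 0 := by
    have h := one_le_waveLength hk
    have h2 : (∑ j, (k j : ℂ) ^ 2) = ((waveLength k ^ 2 : ℝ) : ℂ) := by
      rw [waveLength_sq]
      push_cast
      rfl
    rw [h2]
    exact_mod_cast (by positivity : waveLength k ^ 2 ≠ 0)
  have : ∀ j, (k j : ℂ) * leray k w j = (k j : ℂ) * w j -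
      (∑ j, (k j : ℂ) * w j) / (∑ j, (k j : ℂ) ^ 2) * (k j : ℂ) ^ 2 := by
    intro j
    simp only [leray]
    ring
  simp only [this]
  rw [Finset.sum_sub_distrib, ← Finset.mul_sum, div_mul_cancel₀ _ hq, sub_self]

lemma taylorCoeff_apply_zero {a : (Fin d → ℤ) → Vec d} (ha : a 0 = 0) (n : ℕ) :
    taylorCoeff a n 0 = 0 := by
  cases n with
  | zero => rw [taylorCoeff_zero, ha]
  | succ n => simp [taylorCoeff_succ, convB_zero]

lemma sum_mul_taylorCoeff {a : (Fin d → ℤ) → Vec d} {k : Fin d → ℤ}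
    (ha : ∑ j, (k j : ℂ) * a k j = 0) (n : ℕ) : ∑ j, (k j : ℂ) * taylorCoeff a n k j = 0 := by
  cases n with
  | zero => rw [taylorCoeff_zero, ha]
  | succ n =>
    simp only [taylorCoeff_succ, PiLp.smul_apply, smul_eq_mul, WithLp.ofLp_sum, Finset.sum_apply]
    simp only [mul_left_comm _ (-((n : ℂ) + 1)⁻¹), ← Finset.mul_sum]
    rw [mul_eq_zero]
    right
    simp only [Finset.mul_sum]
    rw [Finset.sum_comm]
    exact Finset.sum_eq_zero fun p _ => sum_mul_leray k _

/-- The Gevrey norm of a sequence of Fourier coefficients (without the factor `(2π)^{d/2}`). -/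
def seqGevreyNorm (r β : ℝ) (a : (Fin d → ℤ) → Vec d) : ℝ≥0∞ :=
  ell2 fun k => gevreyWeight r β k * ‖a k‖ₑ

/-- The constant in the bilinear estimate. -/
def bilinearConst (d : ℕ) (r : ℝ) : ℝ≥0∞ :=
  ENNReal.ofReal (2 ^ r) * (4 * d * latticeConst d + 1)

lemma seqGevreyNorm_convB_le {r β η : ℝ} (hr : ((d : ℝ) + 1) / 2 ≤ r) (hβ : 0 ≤ β)
    (hη : 0 < η) {a b : (Fin d → ℤ) → Vec d} (ha : a 0 = 0) (hb : b 0 = 0) :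
    seqGevreyNorm r β (convB a b) ≤ bilinearConst d r * ENNReal.ofReal (1 / (Real.exp 1 * η)) *
      (seqGevreyNorm r (β + η) a * seqGevreyNorm r (β + η) b) := by
  refine (ell2_gevreyWeight_convB_le hr hβ hη ha hb).trans ?_
  refine mul_le_mul_left (mul_le_mul_left ?_ _) _
  calc 4 * d * (ENNReal.ofReal (2 ^ r) * latticeConst d)
      = ENNReal.ofReal (2 ^ r) * (4 * d * latticeConst d) := by ring
    _ ≤ _ := mul_le_mul_right le_self_add _

lemma catalan_le_four_pow (n : ℕ) : catalan n ≤ 4 ^ n := by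
  rw [catalan_eq_centralBinom_div]
  refine (Nat.div_le_self _ _).trans ?_
  rw [Nat.centralBinom, show (4 : ℕ) = 2 ^ 2 by norm_num, ← pow_mul]
  exact Nat.choose_le_two_pow _ _

/-- This is `(1 + 1/n)ⁿ ≤ e`; the case `n = 0` relies on `0 ^ 0 = 1`. -/
lemma pow_le_exp_one_mul_pow {s : ℝ} (hs : 0 ≤ s) (n : ℕ) :
    s ^ n ≤ Real.exp 1 * (s * (n / (n + 1))) ^ n := by
  rcases n.eq_zero_or_pos with rfl | hn
  · simp
  have hn' : (0 : ℝ) < n := by exact_mod_cast hn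
  have h1 : (1 + 1 / (n : ℝ)) ^ n ≤ Real.exp 1 := by
    calc (1 + 1 / (n : ℝ)) ^ n ≤ (Real.exp (1 / n)) ^ n := by
          gcongr
          linarith [Real.add_one_le_exp (1 / (n : ℝ))]
      _ = Real.exp 1 := by
          rw [← Real.exp_nat_mul, mul_one_div_cancel hn'.ne']
  calc s ^ n = (1 + 1 / (n : ℝ)) ^ n * (s * (n / (n + 1))) ^ n := by
        rw [← mul_pow]
        congr 1
        field_simp
    _ ≤ _ := by gcongr

/-- Cauchy-Kovalevskaya bound with Catalan majorant. -/
lemma seqGevreyNorm_taylorCoeff_mul_le {r β₀ : ℝ} (hr : ((d : ℝ) + 1) / 2 ≤ r)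
    {a : (Fin d → ℤ) → Vec d} (ha : a 0 = 0) (n : ℕ) {s : ℝ} (hs : 0 ≤ s) (hsβ : s ≤ β₀) :
    seqGevreyNorm r (β₀ - s) (taylorCoeff a n) * ENNReal.ofReal s ^ n ≤
      seqGevreyNorm r β₀ a * catalan n *
        (bilinearConst d r * seqGevreyNorm r β₀ a) ^ n := by
  set M := seqGevreyNorm r β₀ a
  set K := bilinearConst d r
  -- The radius loss `s` must vary: the step at `s` calls the hypothesis at `s' = s n/(n+1)`.
  induction n using Nat.strong_induction_on generalizing s with
  | _ n ih =>
  cases n with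
  | zero =>
    simp only [taylorCoeff_zero, pow_zero, mul_one, catalan_zero, Nat.cast_one]
    exact ell2_mono fun k => mul_le_mul_left (gevreyWeight_mono (by linarith) k) _
  | succ n =>
    rcases hs.eq_or_lt with rfl | hs0
    · simp
    -- The last of `n + 1` equal losses of radius, leaving `s - η = s'` for the earlier
    -- coefficients.
    set η := s / (n + 1)
    have hη : 0 < η := by positivity
    set s' := s * (n / (n + 1))
    have hs' : 0 ≤ s' := by positivity
    have hss : s - η = s' := by
      simp only [η, s']
      field_simp
      ring
    have hβη : β₀ - s + η = β₀ - s' := by rw [← hss]; ring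
    set X : ℕ → ℝ≥0∞ := fun i => seqGevreyNorm r (β₀ - s') (taylorCoeff a i)
    have henorm : ‖(-((n : ℂ) + 1)⁻¹)‖ₑ = ((n : ℝ≥0∞) + 1)⁻¹ := by
      rw [enorm_neg, enorm_inv (by exact_mod_cast n.succ_ne_zero)]
      congr 1
      rw [← Nat.cast_succ, ← ofReal_norm, Complex.norm_natCast, ENNReal.ofReal_natCast]
      push_cast
      rfl
    have h1 : seqGevreyNorm r (β₀ - s) (taylorCoeff a (n + 1)) ≤
        ((n : ℝ≥0∞) + 1)⁻¹ * ∑ p ∈ Finset.HasAntidiagonal.antidiagonal n,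
          K * ENNReal.ofReal (1 / (Real.exp 1 * η)) * (X p.1 * X p.2) := by
      calc seqGevreyNorm r (β₀ - s) (taylorCoeff a (n + 1))
          ≤ ell2 (fun k => ((n : ℝ≥0∞) + 1)⁻¹ * ∑ p ∈ Finset.HasAntidiagonal.antidiagonal n,
              gevreyWeight r (β₀ - s) k *
                ‖convB (taylorCoeff a p.1) (taylorCoeff a p.2) k‖ₑ) := by
            refine ell2_mono fun k => ?_
            rw [taylorCoeff_succ, enorm_smul, henorm, ← Finset.mul_sum, mul_left_comm]
            gcongr
            exact enorm_sum_le _ _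
        _ ≤ ((n : ℝ≥0∞) + 1)⁻¹ * ∑ p ∈ Finset.HasAntidiagonal.antidiagonal n,
              seqGevreyNorm r (β₀ - s) (convB (taylorCoeff a p.1) (taylorCoeff a p.2)) := by
            rw [ell2_const_mul]
            gcongr
            exact ell2_sum_le _ _
        _ ≤ _ := by
            refine mul_le_mul_right (Finset.sum_le_sum fun p _ => ?_) _
            rw [show X p.1 = seqGevreyNorm r (β₀ - s + η) (taylorCoeff a p.1) by rw [hβη],
              show X p.2 = seqGevreyNorm r (β₀ - s + η) (taylorCoeff a p.2) by rw [hβη]]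
            exact seqGevreyNorm_convB_le hr (by linarith) hη (taylorCoeff_apply_zero ha _)
              (taylorCoeff_apply_zero ha _)
    -- The balance of the scheme: the left side is exactly `sⁿ/e`, with the two factors `n + 1`
    -- cancelled.
    have h2 : ((n : ℝ≥0∞) + 1)⁻¹ * ENNReal.ofReal (1 / (Real.exp 1 * η)) *
        ENNReal.ofReal s ^ (n + 1) ≤ ENNReal.ofReal s' ^ n := by
      have hcast : ((n : ℝ≥0∞) + 1) = ENNReal.ofReal ((n : ℝ) + 1) := by
        rw [ENNReal.ofReal_add (by positivity) zero_le_one, ENNReal.ofReal_natCast,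
          ENNReal.ofReal_one]
      rw [hcast, ← ENNReal.ofReal_inv_of_pos (by positivity), ← ENNReal.ofReal_pow hs,
        ← ENNReal.ofReal_pow hs', ← ENNReal.ofReal_mul (by positivity),
        ← ENNReal.ofReal_mul (by positivity)]
      apply ENNReal.ofReal_le_ofReal
      have he := Real.exp_pos 1
      have : ((n : ℝ) + 1)⁻¹ * (1 / (Real.exp 1 * η)) * s ^ (n + 1) = s ^ n / Real.exp 1 := by
        simp only [η]
        field_simp
        ring
      rw [this, div_le_iff₀ he, mul_comm]
      exact pow_le_exp_one_mul_pow hs n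
    calc seqGevreyNorm r (β₀ - s) (taylorCoeff a (n + 1)) * ENNReal.ofReal s ^ (n + 1)
        ≤ (((n : ℝ≥0∞) + 1)⁻¹ * ∑ p ∈ Finset.HasAntidiagonal.antidiagonal n,
          K * ENNReal.ofReal (1 / (Real.exp 1 * η)) * (X p.1 * X p.2)) *
            ENNReal.ofReal s ^ (n + 1) := mul_le_mul_left h1 _
      _ = K * (((n : ℝ≥0∞) + 1)⁻¹ * ENNReal.ofReal (1 / (Real.exp 1 * η)) *
            ENNReal.ofReal s ^ (n + 1)) * ∑ p ∈ Finset.HasAntidiagonal.antidiagonal n,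
              X p.1 * X p.2 := by
          rw [← Finset.mul_sum]
          ring
      _ ≤ K * ENNReal.ofReal s' ^ n * ∑ p ∈ Finset.HasAntidiagonal.antidiagonal n,
              X p.1 * X p.2 := by gcongr
      _ = K * ∑ p ∈ Finset.HasAntidiagonal.antidiagonal n,
            (X p.1 * ENNReal.ofReal s' ^ p.1) * (X p.2 * ENNReal.ofReal s' ^ p.2) := by
          rw [mul_assoc, Finset.mul_sum]
          congr 1
          refine Finset.sum_congr rfl fun p hp => ?_
          rw [← Finset.HasAntidiagonal.mem_antidiagonal.1 hp, pow_add]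
          ring
      _ ≤ K * ∑ p ∈ Finset.HasAntidiagonal.antidiagonal n,
            (M * catalan p.1 * (K * M) ^ p.1) * (M * catalan p.2 * (K * M) ^ p.2) := by
          have hsβ' : s' ≤ β₀ := by linarith
          refine mul_le_mul_right (Finset.sum_le_sum fun p hp => ?_) _
          have hp' := Finset.HasAntidiagonal.mem_antidiagonal.1 hp
          exact mul_le_mul' (ih p.1 (by omega) hs' hsβ') (ih p.2 (by omega) hs' hsβ')
      _ = M * catalan (n + 1) * (K * M) ^ (n + 1) := by
          rw [catalan_succ', Nat.cast_sum, Finset.mul_sum, Finset.mul_sum, Finset.sum_mul]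
          refine Finset.sum_congr rfl fun p hp => ?_
          have : (K * M) ^ (n + 1) = K * M * ((K * M) ^ p.1 * (K * M) ^ p.2) := by
            rw [← pow_add, Finset.HasAntidiagonal.mem_antidiagonal.1 hp, pow_succ']
          rw [this]
          push_cast
          ring

lemma eq_zero_of_seqGevreyNorm_eq_zero {r β : ℝ} (hr : 0 ≤ r) (hβ : 0 ≤ β)
    {a : (Fin d → ℤ) → Vec d} (ha : a 0 = 0) (h : seqGevreyNorm r β a = 0) : a = 0 := by
  ext1 k
  by_cases hk : k = 0
  · rw [hk, ha]
    rfl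
  have h1 := le_ell2 (fun k => gevreyWeight r β k * ‖a k‖ₑ) k
  have h2 : ‖a k‖ₑ ≤ 0 := by
    calc ‖a k‖ₑ = 1 * ‖a k‖ₑ := (one_mul _).symm
      _ ≤ gevreyWeight r β k * ‖a k‖ₑ := mul_le_mul_left (one_le_gevreyWeight hr hβ hk) _
      _ ≤ 0 := h1.trans h.le
  simpa using h2

lemma bilinearConst_ne_zero (d : ℕ) (r : ℝ) : bilinearConst d r ≠ 0 := by
  unfold bilinearConst
  have : 0 < (2 : ℝ) ^ r := by positivity
  simp [this]

/-- Geometric decay of the Taylor coefficients in Gevrey classes. -/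
lemma seqGevreyNorm_taylorCoeff_mul_pow_le {r β₀ β ρ : ℝ} (hr : ((d : ℝ) + 1) / 2 ≤ r)
    (hβ₀ : 0 < β₀) (hβ : 0 ≤ β) (hρ : 0 < ρ)
    {a : (Fin d → ℤ) → Vec d} (ha : a 0 = 0)
    (h : 4 * bilinearConst d r * seqGevreyNorm r β₀ a * ENNReal.ofReal ρ ≤
      ENNReal.ofReal (β₀ - β)) (n : ℕ) :
    seqGevreyNorm r β (taylorCoeff a n) * ENNReal.ofReal ρ ^ n ≤ seqGevreyNorm r β₀ a := by
  have hr0 : 0 ≤ r := le_trans (by positivity) hr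
  set M := seqGevreyNorm r β₀ a
  set K := bilinearConst d r
  -- For zero data the hypothesis `h` says nothing about `β`; losing the whole radius `β₀` shows
  -- that every Taylor coefficient is zero.
  by_cases hM : M = 0
  · have h1 := seqGevreyNorm_taylorCoeff_mul_le hr ha n hβ₀.le le_rfl
    have h2 : seqGevreyNorm r (β₀ - β₀) (taylorCoeff a n) = 0 := by
      have h3 : ENNReal.ofReal β₀ ^ n ≠ 0 := pow_ne_zero _ (by simpa using hβ₀)
      change _ ≤ M * _ * _ at h1
      rw [hM] at h1
      simpa [h3] using h1
    have h3 := eq_zero_of_seqGevreyNorm_eq_zero hr0 (by simp) (taylorCoeff_apply_zero ha n) h2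
    simp [h3, seqGevreyNorm, ell2]
  set s := β₀ - β
  -- Here `K ≠ 0` matters, which the summand `+ 1` in `bilinearConst` guarantees.
  have hs0 : 0 < s := by
    by_contra hs
    rw [ENNReal.ofReal_of_nonpos (not_lt.1 hs)] at h
    simp [hM, hρ.not_ge, K, bilinearConst_ne_zero] at h
  have h1 := seqGevreyNorm_taylorCoeff_mul_le hr ha n hs0.le (show s ≤ β₀ by simp [s, hβ])
  rw [show β₀ - s = β by simp [s]] at h1
  have hS0 : ENNReal.ofReal s ^ n ≠ 0 := pow_ne_zero _ (by simpa using hs0)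
  have hSt : ENNReal.ofReal s ^ n ≠ ∞ := by finiteness
  rw [← ENNReal.mul_le_mul_iff_left hS0 hSt]
  calc seqGevreyNorm r β (taylorCoeff a n) * ENNReal.ofReal ρ ^ n * ENNReal.ofReal s ^ n
      = seqGevreyNorm r β (taylorCoeff a n) * ENNReal.ofReal s ^ n * ENNReal.ofReal ρ ^ n := by
        ring
    _ ≤ M * catalan n * (K * M) ^ n * ENNReal.ofReal ρ ^ n := mul_le_mul_left h1 _
    _ ≤ M * 4 ^ n * (K * M) ^ n * ENNReal.ofReal ρ ^ n := by
        gcongr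
        exact_mod_cast catalan_le_four_pow n
    _ = M * (4 * K * M * ENNReal.ofReal ρ) ^ n := by
        simp only [mul_pow]
        ring
    _ ≤ M * ENNReal.ofReal s ^ n := by gcongr

/-! ### Power series in Banach spaces -/

section PowerSeries

variable {E F G : Type*} [NormedAddCommGroup E] [NormedSpace ℂ E] [NormedAddCommGroup F]
  [NormedSpace ℂ F] [NormedAddCommGroup G] [NormedSpace ℂ G]

lemma summable_norm_pow_smul {a : ℕ → E} {ρ M : ℝ} (hρ : 0 < ρ) (ha : ∀ n, ‖a n‖ * ρ ^ n ≤ M)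
    {ζ : ℂ} (hζ : ‖ζ‖ < ρ) : Summable fun n => ‖ζ ^ n • a n‖ := by
  have hq : ‖ζ‖ / ρ < 1 := (div_lt_one hρ).2 hζ
  refine Summable.of_nonneg_of_le (fun _ => norm_nonneg _) (fun n => ?_)
    ((summable_geometric_of_lt_one (by positivity) hq).mul_left M)
  rw [norm_smul, norm_pow, div_pow, mul_div_assoc', le_div_iff₀ (by positivity)]
  calc ‖ζ‖ ^ n * ‖a n‖ * ρ ^ n = ‖a n‖ * ρ ^ n * ‖ζ‖ ^ n := by ring
    _ ≤ M * ‖ζ‖ ^ n := by gcongr; exact ha n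

lemma exists_hasDerivAt_tsum_pow_smul [CompleteSpace E] {a : ℕ → E} {ρ M : ℝ} (hρ : 0 < ρ)
    (ha : ∀ n, ‖a n‖ * ρ ^ n ≤ M) {ζ : ℂ} (hζ : ‖ζ‖ < ρ) :
    ∃ w, HasDerivAt (fun z : ℂ => ∑' n, z ^ n • a n) w ζ ∧
      HasSum (fun n : ℕ => ζ ^ n • ((n : ℂ) + 1) • a (n + 1)) w := by
  -- On the ball of intermediate radius `ρ'` the series has a summable majorant, so it may be
  -- differentiated termwise.
  obtain ⟨ρ', h1, h2⟩ := exists_between hζ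
  have hρ' : 0 < ρ' := (norm_nonneg ζ).trans_lt h1
  have hsum : Summable fun n => ‖(ρ' : ℂ) ^ n • a n‖ :=
    summable_norm_pow_smul hρ ha (by rwa [Complex.norm_of_nonneg hρ'.le])
  have hdiff : ∀ n, DifferentiableOn ℂ (fun z : ℂ => z ^ n • a n) (Metric.ball 0 ρ') := fun n =>
    ((differentiable_id.pow n).smul_const (a n)).differentiableOn
  have hle : ∀ (n : ℕ) (z : ℂ), z ∈ Metric.ball (0 : ℂ) ρ' →
      ‖z ^ n • a n‖ ≤ ‖(ρ' : ℂ) ^ n • a n‖ := by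
    intro n z hz
    rw [norm_smul, norm_smul, norm_pow, norm_pow, Complex.norm_of_nonneg hρ'.le]
    have := (mem_ball_zero_iff.1 hz).le
    gcongr
  have hmem : ζ ∈ Metric.ball (0 : ℂ) ρ' := mem_ball_zero_iff.2 h1
  have hd := Complex.differentiableOn_tsum_of_summable_norm hsum hdiff Metric.isOpen_ball hle
  have hs := Complex.hasSum_deriv_of_summable_norm hsum hdiff Metric.isOpen_ball hle hmem
  refine ⟨_, (hd.differentiableAt (Metric.isOpen_ball.mem_nhds hmem)).hasDerivAt, ?_⟩
  rw [← hasSum_nat_add_iff' 1] at hs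
  have hderiv : ∀ n : ℕ, deriv (fun z : ℂ => z ^ n • a n) ζ = ((n : ℂ) * ζ ^ (n - 1)) • a n :=
    fun n => ((hasDerivAt_pow n ζ).smul_const (a n)).deriv
  simp only [hderiv] at hs
  simpa [smul_smul, mul_comm] using hs

/-- Cauchy product for a continuous bilinear map. -/
lemma hasSum_bilinear_antidiagonal [CompleteSpace E] [CompleteSpace F] [CompleteSpace G]
    (B : E →L[ℂ] F →L[ℂ] G) {x : ℕ → E} {y : ℕ → F} (hx : Summable fun n => ‖x n‖)
    (hy : Summable fun n => ‖y n‖) :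
    HasSum (fun n => ∑ p ∈ Finset.HasAntidiagonal.antidiagonal n, B (x p.1) (y p.2))
      (B (∑' n, x n) (∑' n, y n)) := by
  have hs : Summable fun p : ℕ × ℕ => B (x p.1) (y p.2) := by
    refine Summable.of_norm_bounded ((hx.mul_of_nonneg hy (fun _ => norm_nonneg _)
      fun _ => norm_nonneg _).mul_left ‖B‖) fun p => ?_
    rw [← mul_assoc]
    exact B.le_opNorm₂ _ _
  have hval : ∑' p : ℕ × ℕ, B (x p.1) (y p.2) = B (∑' n, x n) (∑' n, y n) := by
    rw [hs.tsum_prod]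
    have h1 : ∀ i, ∑' j, B (x i) (y j) = B (x i) (∑' n, y n) := fun i =>
      ((B (x i)).map_tsum hy.of_norm).symm
    simp only [h1]
    exact ((B.flip (∑' n, y n)).map_tsum hx.of_norm).symm
  have h2 : HasSum (fun p : ℕ × ℕ => B (x p.1) (y p.2)) (B (∑' n, x n) (∑' n, y n)) :=
    hval ▸ hs.hasSum
  rw [← Finset.HasAntidiagonal.sigmaAntidiagonalEquivProd.hasSum_iff] at h2
  convert h2.sigma fun n => hasSum_fintype _ using 2 with n
  exact (Finset.sum_coe_sort _ (fun p : ℕ × ℕ => B (x p.1) (y p.2))).symm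

/-- Analytic solutions of a quadratic equation `u' = -B(u, u)`, tested against a separating family
of functionals, are determined by their initial value. -/
lemma eventuallyEq_of_quadratic_ode [CompleteSpace E] {κ : Type*} {L : κ → E →L[ℂ] F}
    {B : κ → E →L[ℂ] E →L[ℂ] F}
    (hL : ∀ x, (∀ k, L k x = 0) → x = 0) {u v : ℂ → E} (hu : AnalyticAt ℂ u 0)
    (hv : AnalyticAt ℂ v 0) (h0 : u 0 = v 0)
    (hu' : ∀ᶠ z in 𝓝[≠] (0 : ℂ), ∀ k, L k (deriv u z) = -B k (u z) (u z))
    (hv' : ∀ᶠ z in 𝓝[≠] (0 : ℂ), ∀ k, L k (deriv v z) = -B k (v z) (v z)) :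
    u =ᶠ[𝓝 0] v := by
  by_contra hne
  have hne' : ¬ ∀ᶠ z in 𝓝 (0 : ℂ), (u - v) z = 0 := by
    contrapose! hne
    filter_upwards [hne] with z hz
    exact sub_eq_zero.1 hz
  -- Write `u - v = zⁿ g` with `g 0 ≠ 0`; equal initial values force `n = m + 1`.
  obtain ⟨n, g, hg, hg0, hgz⟩ := (hu.sub hv).exists_eventuallyEq_pow_smul_nonzero_iff.2 hne'
  simp only [sub_zero] at hgz
  have hn : n ≠ 0 := by
    rintro rfl
    have := hgz.self_of_nhds
    simp [h0] at this
    exact hg0 this.symm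
  obtain ⟨m, rfl⟩ := Nat.exists_eq_succ_of_ne_zero hn
  refine hg0 (hL _ fun k => ?_)
  -- The difference of the two equations divided by `z^m`. Its right side is `O(z)`, so in the limit
  -- `(m + 1) L k (g 0) = 0`.
  have hkey : ∀ᶠ z in 𝓝[≠] (0 : ℂ), L k (((m : ℂ) + 1) • g z + z • deriv g z) =
      -(z • (B k (u z) (g z) + B k (g z) (v z))) := by
    filter_upwards [nhdsWithin_le_nhds hgz.eventually_nhds, hu', hv',
      nhdsWithin_le_nhds hg.eventually_analyticAt, nhdsWithin_le_nhds hu.eventually_analyticAt,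
      nhdsWithin_le_nhds hv.eventually_analyticAt, self_mem_nhdsWithin]
      with z hz hzu hzv hgz' huz hvz hz0
    have h1 : HasDerivAt (u - v) (deriv u z - deriv v z) z :=
      huz.differentiableAt.hasDerivAt.sub hvz.differentiableAt.hasDerivAt
    have h2 : HasDerivAt (u - v)
        (z ^ (m + 1) • deriv g z + (((m + 1 : ℕ) : ℂ) * z ^ m) • g z) z :=
      ((hasDerivAt_pow (m + 1) z).smul hgz'.differentiableAt.hasDerivAt).congr_of_eventuallyEq hz
    have h3 := congrArg (L k) (h1.unique h2)
    have h6 : u z - v z = z ^ (m + 1) • g z := hz.self_of_nhds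
    have h7 : B k (u z) (u z) - B k (v z) (v z) =
        B k (u z) (u z - v z) + B k (u z - v z) (v z) := by
      simp [map_sub]
    have h4 : L k (deriv u z - deriv v z) =
        -(z ^ (m + 1) • (B k (u z) (g z) + B k (g z) (v z))) := by
      have h8 : B k (u z) (u z) - B k (v z) (v z) =
          z ^ (m + 1) • (B k (u z) (g z) + B k (g z) (v z)) := by
        rw [h7, h6]
        simp
      rw [map_sub, hzu k, hzv k, ← h8]
      abel
    have hzm : z ^ m ≠ 0 := pow_ne_zero _ hz0
    refine smul_right_injective _ hzm ?_
    simp only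
    rw [← map_smul, smul_neg, smul_smul, ← pow_succ, ← h4, h3]
    congr 1
    rw [smul_add, smul_smul, smul_smul, ← pow_succ, add_comm, mul_comm (z ^ m)]
    push_cast
    rfl
  have hl : Tendsto (fun z : ℂ => L k (((m : ℂ) + 1) • g z + z • deriv g z)) (𝓝[≠] 0)
      (𝓝 (L k (((m : ℂ) + 1) • g 0 + (0 : ℂ) • deriv g 0))) := by
    refine Tendsto.mono_left ?_ nhdsWithin_le_nhds
    refine ((L k).continuous.tendsto _).comp ?_
    exact (hg.continuousAt.const_smul _).add (continuousAt_id.smul hg.deriv.continuousAt)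
  have hr : Tendsto (fun z : ℂ => -(z • (B k (u z) (g z) + B k (g z) (v z))))
      (𝓝[≠] 0) (𝓝 (-((0 : ℂ) • (B k (u 0) (g 0) + B k (g 0) (v 0))))) := by
    refine Tendsto.mono_left ?_ nhdsWithin_le_nhds
    have hc1 : ContinuousAt (fun z => B k (u z) (g z)) 0 :=
      ((B k).continuous.continuousAt.comp hu.continuousAt).clm_apply hg.continuousAt
    have hc2 : ContinuousAt (fun z => B k (g z) (v z)) 0 :=
      ((B k).continuous.continuousAt.comp hg.continuousAt).clm_apply hv.continuousAt
    exact (continuousAt_id.smul (hc1.add hc2)).neg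
  have hlim := tendsto_nhds_unique (hl.congr' hkey) hr
  have hm : (m : ℂ) + 1 ≠ 0 := by exact_mod_cast m.succ_ne_zero
  simpa only [zero_smul, add_zero, neg_zero, map_smul, smul_eq_zero, hm, false_or] using hlim

end PowerSeries

/-! ### Uniqueness of holomorphic solutions -/

/-- Removable singularity: continuity at `0` is precisely the initial condition. -/
lemma IsEulerSolution.analyticOnNhd_update {u₀ : L2 d} {U : Set ℂ} {u : ℂ → L2 d} (hU : IsOpen U)
    (h0 : (0 : ℂ) ∈ U) (hu : IsEulerSolution u₀ (U \ {0}) u) :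
    AnalyticOnNhd ℂ (Function.update u 0 u₀) U := by
  have hV : IsOpen (U \ {0}) := hU.sdiff isClosed_singleton
  have heq : ∀ z ∈ U \ {0}, Function.update u 0 u₀ =ᶠ[𝓝 z] u := fun z hz => by
    filter_upwards [hV.mem_nhds hz] with y hy
    exact Function.update_of_ne hy.2 _ _
  have hd : ∀ z ∈ U \ {0}, DifferentiableAt ℂ (Function.update u 0 u₀) z := fun z hz => by
    obtain ⟨w, hw, -⟩ := hu.eqn z hz
    exact hw.differentiableAt.congr_of_eventuallyEq (heq z hz)
  intro z hz
  by_cases hz0 : z = 0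
  · subst hz0
    refine Complex.analyticAt_of_differentiable_on_punctured_nhds_of_continuousAt ?_ ?_
    · filter_upwards [sdiff_mem_nhdsWithin_compl (hU.mem_nhds h0) _] with y hy
      exact hd y hy
    · rw [continuousAt_update_same]
      refine hu.init.mono_left ?_
      rw [nhdsWithin_le_iff]
      exact sdiff_mem_nhdsWithin_compl (hU.mem_nhds h0) _
  · exact DifferentiableOn.analyticAt (s := U \ {0})
      (fun y hy => (hd y hy).differentiableWithinAt) (hV.mem_nhds ⟨hz, hz0⟩)

lemma IsEulerSolution.eventually_eqn {u₀ : L2 d} {U : Set ℂ} {u : ℂ → L2 d} (hU : IsOpen U)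
    (h0 : (0 : ℂ) ∈ U) (hu : IsEulerSolution u₀ (U \ {0}) u) :
    ∀ᶠ z in 𝓝[≠] (0 : ℂ), ∀ k, coeffL k (deriv (Function.update u 0 u₀) z) =
      -eulerBL k (Function.update u 0 u₀ z) (Function.update u 0 u₀ z) := by
  filter_upwards [sdiff_mem_nhdsWithin_compl (hU.mem_nhds h0) {0}] with z hz k
  have hV : IsOpen (U \ {0}) := hU.sdiff isClosed_singleton
  obtain ⟨w, hw, hwk⟩ := hu.eqn z hz
  have heq : Function.update u 0 u₀ =ᶠ[𝓝 z] u := by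
    filter_upwards [hV.mem_nhds hz] with y hy
    exact Function.update_of_ne hy.2 _ _
  rw [(hw.congr_of_eventuallyEq heq).deriv, Function.update_of_ne hz.2, coeffL_apply,
    eq_neg_of_add_eq_zero_left (hwk k), eulerBL_apply]

lemma IsEulerSolution.eventuallyEq {u₀ : L2 d} {U : Set ℂ} {u v : ℂ → L2 d} (hU : IsOpen U)
    (h0 : (0 : ℂ) ∈ U) (hu : IsEulerSolution u₀ (U \ {0}) u)
    (hv : IsEulerSolution u₀ (U \ {0}) v) :
    Function.update u 0 u₀ =ᶠ[𝓝 0] Function.update v 0 u₀ := by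
  refine eventuallyEq_of_quadratic_ode (L := coeffL) (B := eulerBL) (fun x hx => ?_)
    (hu.analyticOnNhd_update hU h0 0 h0) (hv.analyticOnNhd_update hU h0 0 h0) (by simp)
    (hu.eventually_eqn hU h0) (hv.eventually_eqn hU h0)
  exact ext_coeff fun k => by rw [← coeffL_apply, ← coeffL_apply, hx k, map_zero]

lemma IsEulerSolution.eqOn {u₀ : L2 d} {U : Set ℂ} {u v : ℂ → L2 d} (hU : IsOpen U)
    (hUc : IsPreconnected U) (h0 : (0 : ℂ) ∈ U) (hu : IsEulerSolution u₀ (U \ {0}) u)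
    (hv : IsEulerSolution u₀ (U \ {0}) v) : Set.EqOn u v (U \ {0}) := by
  have h := (hu.analyticOnNhd_update hU h0).eqOn_of_preconnected_of_eventuallyEq
    (hv.analyticOnNhd_update hU h0) hUc h0 (hu.eventuallyEq hU h0 hv)
  intro z hz
  simpa [Function.update_of_ne hz.2] using h hz.1

/-! ### Realising the power series in `L²` -/

lemma exists_coeff_eq_of_ell2 {a : (Fin d → ℤ) → Vec d} (ha : ell2 (fun k => ‖a k‖ₑ) ≠ ∞) :
    ∃ u : L2 d, ∀ k : Fin d → ℤ, coeff u k = a k := by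
  refine exists_coeff_eq ?_
  have h : ∑' k, ENNReal.ofReal (‖a k‖ ^ 2) ≠ ∞ := by
    have h2 : ∑' k, ENNReal.ofReal (‖a k‖ ^ 2) = ell2 (fun k => ‖a k‖ₑ) ^ 2 := by
      simp only [ell2_sq, ← ofReal_norm, ENNReal.ofReal_pow (norm_nonneg _)]
    rw [h2]
    finiteness
  refine (ENNReal.summable_toReal h).congr fun k => ?_
  rw [ENNReal.toReal_ofReal (sq_nonneg _)]

lemma enorm_eq_volSqrt_mul_ell2 (u : L2 d) :
    ‖u‖ₑ = ENNReal.ofReal (volSqrt d) * ell2 (fun k : Fin d → ℤ => ‖coeff u k‖ₑ) := by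
  have h := hasSum_norm_coeff_sq u
  have hpos : 0 < (2 * Real.pi) ^ d := pow_pos Real.two_pi_pos d
  have h1 : ell2 (fun k : Fin d → ℤ => ‖coeff u k‖ₑ) ^ 2 =
      ENNReal.ofReal (((2 * Real.pi) ^ d)⁻¹ * ‖u‖ ^ 2) := by
    rw [← h.tsum_eq, ENNReal.ofReal_tsum_of_nonneg (fun _ => sq_nonneg _) h.summable, ell2_sq]
    simp only [← ofReal_norm, ENNReal.ofReal_pow (norm_nonneg _)]
  have h2 : ‖u‖ₑ ^ 2 =
      (ENNReal.ofReal (volSqrt d) * ell2 (fun k : Fin d → ℤ => ‖coeff u k‖ₑ)) ^ 2 := by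
    rw [mul_pow, h1, ← ENNReal.ofReal_pow (volSqrt_pos d).le, volSqrt_sq,
      ← ENNReal.ofReal_mul hpos.le, mul_inv_cancel_left₀ hpos.ne',
      ENNReal.ofReal_pow (norm_nonneg _), ofReal_norm]
  exact le_antisymm ((ENNReal.pow_le_pow_left_iff two_ne_zero).1 h2.le)
    ((ENNReal.pow_le_pow_left_iff two_ne_zero).1 h2.ge)

lemma ell2_enorm_le_seqGevreyNorm {r β : ℝ} (hr : 0 ≤ r) (hβ : 0 ≤ β)
    {a : (Fin d → ℤ) → Vec d} (ha : a 0 = 0) :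
    ell2 (fun k => ‖a k‖ₑ) ≤ seqGevreyNorm r β a := by
  refine ell2_mono fun k => ?_
  by_cases hk : k = 0
  · simp [hk, ha]
  · calc ‖a k‖ₑ = 1 * ‖a k‖ₑ := (one_mul _).symm
      _ ≤ _ := mul_le_mul_left (one_le_gevreyWeight hr hβ hk) _

lemma norm_mul_pow_le_of_ell2 {u : L2 d} {ρ : ℝ} {M : ℝ≥0∞} {n : ℕ} (hρ : 0 ≤ ρ) (hM : M ≠ ∞)
    (h : ell2 (fun k : Fin d → ℤ => ‖coeff u k‖ₑ) * ENNReal.ofReal ρ ^ n ≤ M) :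
    ‖u‖ * ρ ^ n ≤ volSqrt d * M.toReal := by
  have h1 : ENNReal.ofReal (‖u‖ * ρ ^ n) ≤ ENNReal.ofReal (volSqrt d * M.toReal) := by
    rw [ENNReal.ofReal_mul (norm_nonneg _), ENNReal.ofReal_mul (volSqrt_pos d).le,
      ENNReal.ofReal_toReal hM, ofReal_norm, enorm_eq_volSqrt_mul_ell2, mul_assoc,
      ENNReal.ofReal_pow hρ]
    gcongr
  have := volSqrt_pos d
  exact (ENNReal.ofReal_le_ofReal_iff (by positivity)).1 h1

/-- Radii of convergence `ρ` of the Taylor series in the Gevrey class of radius `β`. -/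
def Admissible (r β₀ : ℝ) (a : (Fin d → ℤ) → Vec d) (β ρ : ℝ) : Prop :=
  0 ≤ β ∧ 0 < ρ ∧ 4 * bilinearConst d r * seqGevreyNorm r β₀ a * ENNReal.ofReal ρ ≤
    ENNReal.ofReal (β₀ - β)

section Series

variable {r β₀ β ρ : ℝ} {a : (Fin d → ℤ) → Vec d} {U : ℕ → L2 d}

lemma Admissible.seqGevreyNorm_taylorCoeff_ne_top (hr : ((d : ℝ) + 1) / 2 ≤ r) (hβ₀ : 0 < β₀)
    (ha : a 0 = 0) (haM : seqGevreyNorm r β₀ a ≠ ∞) (h : Admissible r β₀ a β ρ) (n : ℕ) :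
    seqGevreyNorm r β (taylorCoeff a n) ≠ ∞ := by
  intro htop
  have h1 := seqGevreyNorm_taylorCoeff_mul_pow_le hr hβ₀ h.1 h.2.1 ha h.2.2 n
  rw [htop, ENNReal.top_mul (pow_ne_zero _ (by simpa using h.2.1)), top_le_iff] at h1
  exact haM h1

lemma Admissible.exists_coeff_eq_taylorCoeff (hr : ((d : ℝ) + 1) / 2 ≤ r) (hβ₀ : 0 < β₀)
    (ha : a 0 = 0) (haM : seqGevreyNorm r β₀ a ≠ ∞) (h : Admissible r β₀ a β ρ) :
    ∃ U : ℕ → L2 d, ∀ n (k : Fin d → ℤ), coeff (U n) k = taylorCoeff a n k := by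
  have hex : ∀ n, ∃ u : L2 d, ∀ k : Fin d → ℤ, coeff u k = taylorCoeff a n k := fun n =>
    exists_coeff_eq_of_ell2 (ne_top_of_le_ne_top
      (h.seqGevreyNorm_taylorCoeff_ne_top hr hβ₀ ha haM n)
      (ell2_enorm_le_seqGevreyNorm (le_trans (by positivity) hr) h.1 (taylorCoeff_apply_zero ha n)))
  choose U hU using hex
  exact ⟨U, hU⟩

lemma Admissible.norm_mul_pow_le (hr : ((d : ℝ) + 1) / 2 ≤ r) (hβ₀ : 0 < β₀)
    (ha : a 0 = 0) (haM : seqGevreyNorm r β₀ a ≠ ∞) (h : Admissible r β₀ a β ρ)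
    (hU : ∀ n (k : Fin d → ℤ), coeff (U n) k = taylorCoeff a n k) (n : ℕ) :
    ‖U n‖ * ρ ^ n ≤ volSqrt d * (seqGevreyNorm r β₀ a).toReal := by
  refine norm_mul_pow_le_of_ell2 h.2.1.le haM
    (le_trans ?_ (seqGevreyNorm_taylorCoeff_mul_pow_le hr hβ₀ h.1 h.2.1 ha h.2.2 n))
  simp only [hU]
  exact mul_le_mul_left (ell2_enorm_le_seqGevreyNorm (le_trans (by positivity) hr) h.1
    (taylorCoeff_apply_zero ha n)) _

lemma enorm_gevrey_smul (r β : ℝ) (k : Fin d → ℤ) (v : Vec d) :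
    ‖(waveLength k ^ r * Real.exp (β * waveLength k) : ℝ) • v‖ₑ = gevreyWeight r β k * ‖v‖ₑ := by
  have := Real.rpow_nonneg (waveLength_nonneg k) r
  rw [enorm_smul, Real.enorm_of_nonneg (by positivity)]
  rfl

/-- The `ℓ²` norm of the weighted coefficients is the Gevrey norm itself, so the weighted series
obeys the same bound and converges on the same disc. -/
lemma Admissible.exists_gevrey_coeff (hr : ((d : ℝ) + 1) / 2 ≤ r) (hβ₀ : 0 < β₀)
    (ha : a 0 = 0) (haM : seqGevreyNorm r β₀ a ≠ ∞) (h : Admissible r β₀ a β ρ) :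
    ∃ F : ℕ → L2 d, (∀ n (k : Fin d → ℤ), coeff (F n) k =
        (waveLength k ^ r * Real.exp (β * waveLength k) : ℝ) • taylorCoeff a n k) ∧
      ∀ n, ‖F n‖ * ρ ^ n ≤ volSqrt d * (seqGevreyNorm r β₀ a).toReal := by
  have hex : ∀ n, ∃ u : L2 d, ∀ k : Fin d → ℤ, coeff u k =
      (waveLength k ^ r * Real.exp (β * waveLength k) : ℝ) • taylorCoeff a n k := fun n =>
    exists_coeff_eq_of_ell2 (by
      simp only [enorm_gevrey_smul]
      exact h.seqGevreyNorm_taylorCoeff_ne_top hr hβ₀ ha haM n)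
  choose F hF using hex
  refine ⟨F, hF, fun n => norm_mul_pow_le_of_ell2 h.2.1.le haM ?_⟩
  simp only [hF, enorm_gevrey_smul]
  exact seqGevreyNorm_taylorCoeff_mul_pow_le hr hβ₀ h.1 h.2.1 ha h.2.2 n

lemma hasSum_coeff_tsum {ζ : ℂ} (hs : Summable fun n => ‖ζ ^ n • U n‖) (k : Fin d → ℤ) :
    HasSum (fun n => ζ ^ n • coeff (U n) k) (coeff (∑' n, ζ ^ n • U n : L2 d) k) := by
  have h := hs.of_norm.hasSum.mapL (coeffL k)
  simpa only [map_smul, coeffL_apply] using h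

/-- The power series solves the Euler equation. -/
lemma Admissible.exists_hasDerivAt (hr : ((d : ℝ) + 1) / 2 ≤ r) (hβ₀ : 0 < β₀)
    (ha : a 0 = 0) (haM : seqGevreyNorm r β₀ a ≠ ∞) (h : Admissible r β₀ a β ρ)
    (hU : ∀ n (k : Fin d → ℤ), coeff (U n) k = taylorCoeff a n k) {ζ : ℂ} (hζ : ‖ζ‖ < ρ) :
    ∃ w : L2 d, HasDerivAt (fun z : ℂ => ∑' n, z ^ n • U n) w ζ ∧ ∀ k : Fin d → ℤ,
      coeff w k + eulerBCoeff (∑' n, ζ ^ n • U n) (∑' n, ζ ^ n • U n) k = 0 := by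
  have hb := h.norm_mul_pow_le hr hβ₀ ha haM hU
  have hs := summable_norm_pow_smul h.2.1 hb hζ
  obtain ⟨w, hw, hws⟩ := exists_hasDerivAt_tsum_pow_smul h.2.1 hb hζ
  refine ⟨w, hw, fun k => ?_⟩
  have h1 := hws.mapL (coeffL k)
  have h2 := hasSum_bilinear_antidiagonal (eulerBL k) hs hs
  -- The recursion for `taylorCoeff`, read as equality of the `ζⁿ` terms of `u'` and `-B(u, u)`.
  have hterm : ∀ n : ℕ, coeffL k (ζ ^ n • ((n : ℂ) + 1) • U (n + 1)) =
      -∑ p ∈ Finset.HasAntidiagonal.antidiagonal n,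
        eulerBL k (ζ ^ p.1 • U p.1) (ζ ^ p.2 • U p.2) := by
    intro n
    have hn : (n : ℂ) + 1 ≠ 0 := by exact_mod_cast n.succ_ne_zero
    have hU' : ∀ n, coeff (U n) = taylorCoeff a n := fun n => funext (hU n)
    have hp : ∀ p ∈ Finset.HasAntidiagonal.antidiagonal n,
        eulerBL k (ζ ^ p.1 • U p.1) (ζ ^ p.2 • U p.2) =
          ζ ^ n • convB (taylorCoeff a p.1) (taylorCoeff a p.2) k := by
      intro p hp
      rw [map_smul, map_smul, smul_apply, smul_smul, ← pow_add, add_comm p.2,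
        Finset.HasAntidiagonal.mem_antidiagonal.1 hp, eulerBL_apply, eulerBCoeff_eq_convB, hU', hU']
    rw [Finset.sum_congr rfl hp, ← Finset.smul_sum, map_smul, map_smul, coeffL_apply, hU,
      taylorCoeff_succ, smul_smul ((n : ℂ) + 1), mul_neg, mul_inv_cancel₀ hn, neg_smul, one_smul,
      smul_neg]
  simp only [hterm] at h1
  rw [← coeffL_apply, ← eulerBL_apply, h1.unique h2.neg, neg_add_cancel]

lemma mem_HC_tsum {ζ : ℂ} (ha : a 0 = 0)
    (hdiv : ∀ k : Fin d → ℤ, ∑ j, (k j : ℂ) * a k j = 0)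
    (hU : ∀ n (k : Fin d → ℤ), coeff (U n) k = taylorCoeff a n k)
    (hs : Summable fun n => ‖ζ ^ n • U n‖) : (∑' n, ζ ^ n • U n : L2 d) ∈ HC d := by
  refine ⟨?_, fun k => ?_⟩
  · refine (hasSum_coeff_tsum hs 0).unique ?_
    simp only [hU, taylorCoeff_apply_zero ha, smul_zero]
    exact hasSum_zero
  · have h := (hasSum_coeff_tsum hs k).mapL
      (∑ j, (k j : ℂ) • (EuclideanSpace.proj j : Vec d →L[ℂ] ℂ))
    simp only [map_smul, sum_apply, smul_apply, PiLp.proj_apply, smul_eq_mul, hU,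
      sum_mul_taylorCoeff (hdiv k), mul_zero] at h
    exact h.unique hasSum_zero

lemma Admissible.gevreyHolomorphicOn (hr : ((d : ℝ) + 1) / 2 ≤ r) (hβ₀ : 0 < β₀)
    (ha : a 0 = 0) (haM : seqGevreyNorm r β₀ a ≠ ∞) (h : Admissible r β₀ a β ρ)
    (hU : ∀ n (k : Fin d → ℤ), coeff (U n) k = taylorCoeff a n k) :
    GevreyHolomorphicOn r β (fun ζ => ∑' n, ζ ^ n • U n) {ζ : ℂ | 0 < ‖ζ‖ ∧ ‖ζ‖ < ρ} := by
  obtain ⟨F, hF, hFb⟩ := h.exists_gevrey_coeff hr hβ₀ ha haM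
  refine ⟨fun ζ => ∑' n, ζ ^ n • F n, fun ζ hζ => ?_, fun ζ hζ k => ?_⟩
  · obtain ⟨w, hw, -⟩ := exists_hasDerivAt_tsum_pow_smul h.2.1 hFb hζ.2
    exact hw.differentiableAt.differentiableWithinAt
  · have h1 := hasSum_coeff_tsum (summable_norm_pow_smul h.2.1 hFb hζ.2) k
    have h2 := (hasSum_coeff_tsum (summable_norm_pow_smul h.2.1
      (h.norm_mul_pow_le hr hβ₀ ha haM hU) hζ.2) k).const_smul
        (waveLength k ^ r * Real.exp (β * waveLength k) : ℝ)
    refine h1.unique ?_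
    convert h2 using 2 with n
    rw [hF, hU, smul_comm]

end Series

/-! ### Constants -/

/-- Only an inequality is needed, so the factor `(2π)^d ≥ 1` is dropped. -/
lemma seqGevreyNorm_coeff_le {r β : ℝ} {u : L2 d} (hu : MemGevrey r β u) :
    seqGevreyNorm r β (coeff u) ≤ ENNReal.ofReal (gevreyNorm r β u) := by
  have hterm : ∀ k : Fin d → ℤ, 0 ≤ waveLength k ^ (2 * r) *
      Real.exp (2 * β * waveLength k) * ‖coeff u k‖ ^ 2 := fun k => by
    have := Real.rpow_nonneg (waveLength_nonneg k) (2 * r)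
    positivity
  rw [seqGevreyNorm, ell2_le_iff, gevreyNorm, ← ENNReal.ofReal_pow (Real.sqrt_nonneg _),
    Real.sq_sqrt (mul_nonneg (pow_pos Real.two_pi_pos d).le (tsum_nonneg hterm))]
  calc ∑' k : Fin d → ℤ, (gevreyWeight r β k * ‖coeff u k‖ₑ) ^ 2
      = ∑' k : Fin d → ℤ, ENNReal.ofReal (waveLength k ^ (2 * r) *
          Real.exp (2 * β * waveLength k) * ‖coeff u k‖ ^ 2) := by
        refine tsum_congr fun k => ?_
        have hk := waveLength_nonneg k
        have := Real.rpow_nonneg hk r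
        rw [gevreyWeight, ← ofReal_norm, ← ENNReal.ofReal_mul (by positivity),
          ← ENNReal.ofReal_pow (by positivity)]
        congr 1
        rw [mul_pow, mul_pow, ← Real.rpow_mul_natCast hk, ← Real.exp_nat_mul]
        congr 3
        · push_cast
          ring
        · push_cast
          ring
    _ = ENNReal.ofReal (∑' k : Fin d → ℤ, waveLength k ^ (2 * r) *
          Real.exp (2 * β * waveLength k) * ‖coeff u k‖ ^ 2) :=
        (ENNReal.ofReal_tsum_of_nonneg hterm hu).symm
    _ ≤ _ := by
        apply ENNReal.ofReal_le_ofReal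
        refine le_mul_of_one_le_left (tsum_nonneg hterm) (one_le_pow₀ ?_)
        linarith [Real.pi_gt_three]

/-- The constant `C` of the existence theorem. -/
def radiusConst (d : ℕ) : ℝ :=
  1 / (Real.pi * 2 ^ (d - 1)) / (4 * (4 * d * (latticeConst d).toReal + 1))

lemma radiusConst_pos (d : ℕ) : 0 < radiusConst d := by
  have := Real.pi_pos
  have := ENNReal.toReal_nonneg (a := latticeConst d)
  unfold radiusConst
  positivity

/-- The quotient `(2r-d)/(2r-1-d)` is at least `1`; this lower bound, free of `r`, lets `C` depend
on `d` only. -/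
lemma le_wienerConst {r : ℝ} (hr : ((d : ℝ) + 1) / 2 < r) :
    1 / (Real.pi * 2 ^ (d - 1)) ≤ wienerConst d r := by
  have := Real.pi_pos
  refine le_mul_of_one_le_right (by positivity) ?_
  rw [one_le_div (by linarith)]
  linarith

/-- `radiusConst` is chosen so that `4 K C = 2^r / (π 2^{d-1})`, which is at most `2^r C_W(r)`. -/
lemma four_mul_bilinearConst_le {r β₀ ρ : ℝ} {u₀ : L2 d} (hr : ((d : ℝ) + 1) / 2 < r)
    (hu : MemGevrey r β₀ u₀) (hρ : 0 ≤ ρ) :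
    4 * bilinearConst d r * seqGevreyNorm r β₀ (coeff u₀) * ENNReal.ofReal ρ ≤
      ENNReal.ofReal (ρ * dataSize r β₀ u₀ / radiusConst d) := by
  set S := (latticeConst d).toReal
  set N := gevreyNorm r β₀ u₀
  have hN : 0 ≤ N := Real.sqrt_nonneg _
  have hS : 0 ≤ S := ENNReal.toReal_nonneg
  have hK : 4 * bilinearConst d r = ENNReal.ofReal (4 * (2 ^ r * (4 * d * S + 1))) := by
    rw [bilinearConst, ← ENNReal.ofReal_toReal (latticeConst_lt_top d).ne,
      ENNReal.ofReal_mul (by norm_num), ENNReal.ofReal_mul (by positivity),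
      ENNReal.ofReal_add (by positivity) zero_le_one, ENNReal.ofReal_mul (by positivity),
      ENNReal.ofReal_mul (by norm_num), ENNReal.ofReal_natCast, ENNReal.ofReal_ofNat,
      ENNReal.ofReal_one]
  calc 4 * bilinearConst d r * seqGevreyNorm r β₀ (coeff u₀) * ENNReal.ofReal ρ
      ≤ ENNReal.ofReal (4 * (2 ^ r * (4 * d * S + 1))) * ENNReal.ofReal N * ENNReal.ofReal ρ := by
        rw [hK]
        gcongr
        exact seqGevreyNorm_coeff_le hu
    _ = ENNReal.ofReal (4 * (2 ^ r * (4 * d * S + 1)) * N * ρ) := by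
        rw [← ENNReal.ofReal_mul (by positivity), ← ENNReal.ofReal_mul (by positivity)]
    _ ≤ _ := by
        apply ENNReal.ofReal_le_ofReal
        rw [le_div_iff₀ (radiusConst_pos d)]
        have hW := le_wienerConst hr
        have hpi := Real.pi_pos
        calc 4 * (2 ^ r * (4 * d * S + 1)) * N * ρ * radiusConst d
            = ρ * (2 ^ r * (1 / (Real.pi * 2 ^ (d - 1))) * N) := by
              simp only [radiusConst]
              change _ * (_ / (4 * (4 * d * S + 1))) = _
              field_simp
          _ ≤ ρ * (2 ^ r * wienerConst d r * N) := by gcongr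

lemma dataSize_nonneg {r β₀ : ℝ} (u₀ : L2 d) (hr : ((d : ℝ) + 1) / 2 < r) :
    0 ≤ dataSize r β₀ u₀ := by
  have hpi := Real.pi_pos
  have h1 : 0 ≤ wienerConst d r := le_trans (by positivity) (le_wienerConst hr)
  have h2 : 0 ≤ gevreyNorm r β₀ u₀ := Real.sqrt_nonneg _
  unfold dataSize
  positivity

lemma admissible_of_mul_dataSize_lt {r β₀ ρ : ℝ} {u₀ : L2 d} (hr : ((d : ℝ) + 1) / 2 < r)
    (hu : MemGevrey r β₀ u₀) (hρ : 0 < ρ) (h : ρ * dataSize r β₀ u₀ < radiusConst d * β₀) :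
    Admissible r β₀ (coeff u₀) (β₀ - ρ * dataSize r β₀ u₀ / radiusConst d) ρ := by
  refine ⟨?_, hρ, ?_⟩
  · rw [sub_nonneg, div_le_iff₀ (radiusConst_pos d), mul_comm β₀]
    exact h.le
  · rw [sub_sub_cancel]
    exact four_mul_bilinearConst_le hr hu hρ.le

/-- The strict inequality leaves room for a radius `ρ` slightly larger than `‖ζ‖`. -/
lemma exists_admissible_of_norm_mul_lt {r β₀ : ℝ} {u₀ : L2 d} (hr : ((d : ℝ) + 1) / 2 < r)
    (hu : MemGevrey r β₀ u₀) {ζ : ℂ} (h : ‖ζ‖ * dataSize r β₀ u₀ < radiusConst d * β₀) :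
    ∃ β ρ, ‖ζ‖ < ρ ∧ Admissible r β₀ (coeff u₀) β ρ := by
  have hc : ContinuousAt (fun ρ : ℝ => ρ * dataSize r β₀ u₀) ‖ζ‖ := by fun_prop
  have hev : ∀ᶠ ρ in 𝓝[>] ‖ζ‖, ρ * dataSize r β₀ u₀ < radiusConst d * β₀ :=
    nhdsWithin_le_nhds (hc.eventually_lt continuousAt_const h)
  obtain ⟨ρ, h1, h2⟩ := (hev.and self_mem_nhdsWithin).exists
  exact ⟨_, ρ, h2, admissible_of_mul_dataSize_lt hr hu ((norm_nonneg ζ).trans_lt h2) h1⟩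

lemma region_eq (C r β₀ : ℝ) (u₀ : L2 d) :
    region C r β₀ u₀ = {ζ : ℂ | ‖ζ‖ * dataSize r β₀ u₀ < C * β₀} \ {0} := by
  ext ζ
  simp [region, and_comm]

/-- Sublevel sets of a convex function are convex; this treats the disc and, for `D = 0`, the whole
plane together. -/
lemma isPreconnected_norm_mul_lt {D T : ℝ} (hD : 0 ≤ D) :
    IsPreconnected {ζ : ℂ | ‖ζ‖ * D < T} := by
  have h := (convexOn_univ_norm (E := ℂ)).smul hD
  have hc := h.convex_lt T
  simp only [Set.mem_univ, true_and, smul_eq_mul, mul_comm D] at hc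
  exact hc.isPreconnected

end EulerGevrey

end

/-! ### Existence, Gevrey regularity and uniqueness combined -/

open EulerGevrey in
theorem theorem3p1 (d : ℕ) (hd : d = 2 ∨ d = 3) :
    ∃ C : ℝ, 0 < C ∧
      ∀ r : ℝ, ((d : ℝ) + 1) / 2 < r →
      ∀ β₀ : ℝ, 0 < β₀ →
      ∀ u₀ : EulerGevrey.L2 d, u₀ ∈ EulerGevrey.HC d → EulerGevrey.MemGevrey r β₀ u₀ →
        ∃ u : ℂ → EulerGevrey.L2 d,
          EulerGevrey.IsEulerSolution u₀ (EulerGevrey.region C r β₀ u₀) u ∧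
          (∀ ρ : ℝ, 0 < ρ → ρ * EulerGevrey.dataSize r β₀ u₀ < C * β₀ →
            EulerGevrey.GevreyHolomorphicOn r (β₀ - ρ * EulerGevrey.dataSize r β₀ u₀ / C) u
              {ζ : ℂ | 0 < ‖ζ‖ ∧ ‖ζ‖ < ρ}) ∧
          ∀ v : ℂ → EulerGevrey.L2 d,
            EulerGevrey.IsEulerSolution u₀ (EulerGevrey.region C r β₀ u₀) v →
            Set.EqOn v u (EulerGevrey.region C r β₀ u₀) := by
  refine ⟨radiusConst d, radiusConst_pos d, fun r hr β₀ hβ₀ u₀ hu₀ hG => ?_⟩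
  have ha : coeff u₀ 0 = 0 := hu₀.1
  have haM : seqGevreyNorm r β₀ (coeff u₀) ≠ ∞ :=
    ne_top_of_le_ne_top ENNReal.ofReal_ne_top (seqGevreyNorm_coeff_le hG)
  have hT : 0 < radiusConst d * β₀ := mul_pos (radiusConst_pos d) hβ₀
  -- Any admissible pair serves to realise the Taylor coefficients in `L²`. The resulting `U` does
  -- not depend on the pair, so one series covers every `ζ` in the region.
  obtain ⟨_, ρ₀, h00, had⟩ := exists_admissible_of_norm_mul_lt hr hG (ζ := 0) (by simpa using hT)
  obtain ⟨U, hU⟩ := had.exists_coeff_eq_taylorCoeff hr.le hβ₀ ha haM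
  have hU0 : U 0 = u₀ := ext_coeff fun k => by rw [hU, taylorCoeff_zero]
  have hsol : IsEulerSolution u₀ (region (radiusConst d) r β₀ u₀) (fun ζ => ∑' n, ζ ^ n • U n) := by
    refine ⟨fun ζ hζ => ?_, fun ζ hζ => ?_, ?_⟩
    · obtain ⟨β, ρ, hζρ, h⟩ := exists_admissible_of_norm_mul_lt hr hG hζ.2
      exact mem_HC_tsum ha hu₀.2 hU
        (summable_norm_pow_smul h.2.1 (h.norm_mul_pow_le hr.le hβ₀ ha haM hU) hζρ)
    · obtain ⟨β, ρ, hζρ, h⟩ := exists_admissible_of_norm_mul_lt hr hG hζ.2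
      exact h.exists_hasDerivAt hr.le hβ₀ ha haM hU hζρ
    · obtain ⟨w, hw, -⟩ := had.exists_hasDerivAt hr.le hβ₀ ha haM hU h00
      have h0 : (∑' n, (0 : ℂ) ^ n • U n : L2 d) = u₀ := by
        rw [tsum_eq_single 0 fun n hn => by simp [hn], pow_zero, one_smul, hU0]
      have ht : Tendsto (fun ζ : ℂ => ∑' n, ζ ^ n • U n) (𝓝 0)
          (𝓝 (∑' n, (0 : ℂ) ^ n • U n)) := hw.continuousAt
      rw [h0] at ht
      exact ht.mono_left nhdsWithin_le_nhds
  refine ⟨_, hsol, fun ρ hρ hρD => ?_, fun v hv => ?_⟩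
  · exact (admissible_of_mul_dataSize_lt hr hG hρ hρD).gevreyHolomorphicOn hr.le hβ₀ ha haM hU
  -- Uniqueness works on the full disc `U` with the region written as `U \ {0}`, so that the
  -- identity theorem can start at `0`.
  · rw [region_eq] at hv hsol ⊢
    refine hv.eqOn ?_ (isPreconnected_norm_mul_lt (dataSize_nonneg u₀ hr)) ?_ hsol
    · exact isOpen_lt (by fun_prop) continuous_const
    · simpa using hT
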